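/- Let $n\ge 4$, let $B_2$ be the open ball of radius $2$ about the origin in $\mathbb R^n$, and let $\Gamma=\{x\in\mathbb R^n: x_1^2+x_2^2=1,\ x_3=\dots=x_n=0\}$. Let $u\in L^1_{\mathrm{loc}}(B_2\setminus\Gamma)$ be real-valued with $u\ge 0$ almost everywhere and $-\Delta u=0$ in $\mathcal D'(B_2\setminus\Gamma)$, i.e. $\int u\,\Delta\varphi\,dx=0$ for all $\varphi\in C_c^\infty(B_2\setminus\Gamma)$. Then for every real $p$ with $1\le p<\frac{n}{n-2}$: 1. $u\in L^p_{\mathrm{loc}}(B_2)$, i.e. $u\in L^p(K)$ for every compact $K\subset B_2$. 2. There exists a distribution $v\in W^{-2,p}(\Gamma)$ on $\Gamma$ such that for all $\phi\in C_c^\infty(B_2)$ $$\langle -\Delta u,\phi\rangle=\int_{B_2}u\,(-\Delta\phi)\,dx=\langle v,\phi|_\Gamma\rangle .$$ Here $v\in W^{-2,p}(\Gamma)$ means that $v=w_0+w_1'+w_2''$ in the sense of distributions on $\Gamma$ for some $w_0,w_1,w_2\in L^p(\Gamma)$, where $'$ is the derivative with respect to arc length; that is, $\langle v,g\rangle=\int_\Gamma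 (w_0\,g-w_1\,g'+w_2\,g'')\,dl$ for all $g\in C^\infty(\Gamma)$. -/

import Mathlib

open MeasureTheory TopologicalSpace Laplacian Distributions
open scoped ContDiff

/-! ### Locally `L^p` functions and the distributional Laplacian -/

/-- `u ∈ L^p_loc(Ω)`: `u` is in `L^p` on every compact subset of `Ω`. -/
def MemLpLoc {n : ℕ} (u : EuclideanSpace ℝ (Fin n) → ℝ) (p : ℝ)
    (Ω : Opens (EuclideanSpace ℝ (Fin n))) : Prop :=
  ∀ K : Set (EuclideanSpace ℝ (Fin n)), K ⊆ (Ω : Set (EuclideanSpace ℝ (Fin n))) → IsCompact K →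
    MemLp u (ENNReal.ofReal p) (volume.restrict K)

/-- The value `⟨-Δu, φ⟩ = ∫_Ω u (-Δφ)` of the distribution `-Δu ∈ 𝓓'(Ω)` at a test function
`φ ∈ C_c^∞(Ω)`, for `u ∈ L¹_loc(Ω)`. -/
noncomputable def negLaplacianPairing {n : ℕ} {Ω : Opens (EuclideanSpace ℝ (Fin n))}
    (u : EuclideanSpace ℝ (Fin n) → ℝ) (φ : 𝓓(Ω, ℝ)) : ℝ :=
  ∫ x in (Ω : Set (EuclideanSpace ℝ (Fin n))), u x * (-(Δ (φ : EuclideanSpace ℝ (Fin n) → ℝ) x))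

/-- `-Δu = 0` in `𝓓'(Ω)`. -/
def IsDistribHarmonic {n : ℕ} (u : EuclideanSpace ℝ (Fin n) → ℝ)
    (Ω : Opens (EuclideanSpace ℝ (Fin n))) : Prop :=
  ∀ φ : 𝓓(Ω, ℝ), negLaplacianPairing u φ = 0

/-! ### The circle `Γ` in `ℝⁿ`, and the domains -/

/-- The circle `Γ = {x₁² + x₂² = 1, x₃ = ⋯ = xₙ = 0}` in `ℝⁿ` (coordinates are numbered from `0`). -/
def circleΓ {n : ℕ} (hn : 2 ≤ n) : Set (EuclideanSpace ℝ (Fin n)) :=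
  {x | x ⟨0, by omega⟩ ^ 2 + x ⟨1, by omega⟩ ^ 2 = 1 ∧ ∀ i : Fin n, 2 ≤ i.val → x i = 0}

theorem isClosed_circleΓ {n : ℕ} (hn : 2 ≤ n) : IsClosed (circleΓ hn) := by
  have h : circleΓ hn = {x | x ⟨0, by omega⟩ ^ 2 + x ⟨1, by omega⟩ ^ 2 = 1} ∩
      ⋂ i : Fin n, ⋂ _ : 2 ≤ i.val, {x | x i = 0} := by
    ext x
    simp [circleΓ]
  rw [h]
  refine IsClosed.inter (isClosed_eq (by fun_prop) (by fun_prop)) ?_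
  exact isClosed_iInter fun i => isClosed_iInter fun _ => isClosed_eq (by fun_prop) (by fun_prop)

/-- The open ball `B₂` of radius `2` about the origin in `ℝⁿ`. -/
def ballTwo (n : ℕ) : Opens (EuclideanSpace ℝ (Fin n)) :=
  ⟨Metric.ball 0 2, Metric.isOpen_ball⟩

/-- The open set `B₂ \ Γ`. -/
def ballTwoDiffΓ {n : ℕ} (hn : 2 ≤ n) : Opens (EuclideanSpace ℝ (Fin n)) :=
  ⟨Metric.ball 0 2 \ circleΓ hn, Metric.isOpen_ball.sdiff (isClosed_circleΓ hn)⟩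

/-- The vector `(cos θ, sin θ, 0, …, 0)` of `ℝⁿ`. -/
noncomputable def circleVec (n : ℕ) (θ : ℝ) : EuclideanSpace ℝ (Fin n) :=
  WithLp.toLp 2 fun i =>
    if i.val = 0 then Real.cos θ else if i.val = 1 then Real.sin θ else 0

theorem circleVec_mem {n : ℕ} (hn : 2 ≤ n) (θ : ℝ) : circleVec n θ ∈ circleΓ hn := by
  refine ⟨by simp [circleVec], fun i hi => ?_⟩
  have h0 : i.val ≠ 0 := by omega
  have h1 : i.val ≠ 1 := by omega
  simp [circleVec, h0, h1]

/-- The arc-length parametrization `θ ↦ (cos θ, sin θ, 0, …, 0)` of `Γ`. -/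
noncomputable def circleParam {n : ℕ} (hn : 2 ≤ n) (θ : ℝ) : circleΓ hn :=
  ⟨circleVec n θ, circleVec_mem hn θ⟩

theorem contDiff_circleVec (n : ℕ) : ContDiff ℝ ∞ (circleVec n) := by
  rw [contDiff_euclidean]
  intro i
  by_cases h0 : i.val = 0
  · simpa [circleVec, h0] using Real.contDiff_cos
  · by_cases h1 : i.val = 1
    · simpa [circleVec, h1] using Real.contDiff_sin
    · simpa [circleVec, h0, h1] using contDiff_const

/-- The arc-length measure on `Γ`. -/
noncomputable def arcLength {n : ℕ} (hn : 2 ≤ n) : Measure (circleΓ hn) :=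
  (volume.restrict (Set.Ioc 0 (2 * Real.pi))).map (circleParam hn)

/-! ### Distributions and negative Sobolev spaces on `Γ` -/

/-- The space `C^∞(Γ)`: functions on `Γ` that are smooth in the arc-length parameter. -/
def SmoothΓ {n : ℕ} (hn : 2 ≤ n) : Submodule ℝ (circleΓ hn → ℝ) where
  carrier := {g | ContDiff ℝ ∞ fun θ => g (circleParam hn θ)}
  add_mem' {f g} hf hg := by
    rw [Set.mem_ofPred_eq] at hf hg ⊢
    exact hf.add hg
  zero_mem' := by
    rw [Set.mem_ofPred_eq]
    exact contDiff_const
  smul_mem' c g hg := by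
    rw [Set.mem_ofPred_eq] at hg ⊢
    exact contDiff_const.smul hg

/-- The `k`-th tangential (arc-length) derivative `g⁽ᵏ⁾` of `g ∈ C^∞(Γ)` at the point of
parameter `θ`. -/
noncomputable def tangentialDeriv {n : ℕ} {hn : 2 ≤ n} (k : ℕ) (g : SmoothΓ hn) (θ : ℝ) :
    ℝ :=
  iteratedDeriv k (fun t => g.1 (circleParam hn t)) θ

/-- A distribution on `Γ`: a linear functional on `C^∞(Γ)` that is continuous, i.e. bounded by
a constant times the `C^N` norm, for some `N`. -/
structure DistributionΓ {n : ℕ} (hn : 2 ≤ n) where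
  toLinearMap : SmoothΓ hn →ₗ[ℝ] ℝ
  continuous' : ∃ (N : ℕ) (C : ℝ), ∀ (g : SmoothΓ hn) (M : ℝ),
    (∀ k ≤ N, ∀ θ : ℝ, |tangentialDeriv k g θ| ≤ M) → |toLinearMap g| ≤ C * M

/-- `v ∈ W^{-m,p}(Γ)`: there are `w₀, …, w_m ∈ L^p(Γ)` such that `v` is the sum of the
distributional derivatives `w_k⁽ᵏ⁾`, i.e. `⟨v, g⟩ = ∑_k (-1)^k ∫_Γ w_k g⁽ᵏ⁾ dl`. -/
def DistributionΓ.MemNegSobolev {n : ℕ} {hn : 2 ≤ n} (v : DistributionΓ hn) (m : ℕ) (p : ℝ) :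
    Prop :=
  ∃ w : ℕ → circleΓ hn → ℝ,
    (∀ k ≤ m, MemLp (w k) (ENNReal.ofReal p) (arcLength hn)) ∧
    ∀ g : SmoothΓ hn, v.toLinearMap g = ∑ k ∈ Finset.range (m + 1),
      (-1) ^ k * ∫ θ in (0 : ℝ)..(2 * Real.pi), w k (circleParam hn θ) * tangentialDeriv k g θ

/-- The restriction `φ|_Γ ∈ C^∞(Γ)` of a test function `φ`. -/
noncomputable def restrictΓ {n : ℕ} (hn : 2 ≤ n) {Ω : Opens (EuclideanSpace ℝ (Fin n))} (φ : 𝓓(Ω, ℝ)) :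
    SmoothΓ hn :=
  ⟨fun x => φ x.1, φ.contDiff.comp (contDiff_circleVec n)⟩

/-!
The circle `Γ` has codimension `n - 1 ≥ 3`, so it is negligible for superharmonic functions that
are bounded below: `u` extends to a superharmonic function on the whole ball, and `-Δu` is a
nonnegative distribution supported in `Γ`. Both claims follow from this.

*Extension.* For `k > 0` the saturation `k u / (k + u)` is a bounded concave increasing function
of `u`, hence weakly superharmonic off `Γ` (`WeaklySuperharmonicOn.comp_saturate`, by
mollification). Cut-off functions vanishing near `Γ` at scale `ε` have Laplacian `O(ε⁻²)` on a
tube of volume `O(ε ^ (n - 1)) = o(ε²)`, so a bounded superharmonic function extends across `Γ`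
(`WeaklySuperharmonicOn.of_cutoffs`, `exists_cutoffs_circle`). Testing with a cut-off of `‖x‖²`,
which is strictly subharmonic near `Γ`, bounds the integral of the saturations near `Γ` by the
integral of `u` away from `Γ` (`locallyIntegrableOn_of_saturate`); letting `k → ∞`, `u` is locally
integrable and superharmonic on the ball.

*Integrability.* If `h ≥ 1` is smooth and superharmonic and `0 < s < 1`, then `-Δ(h ^ s)` controls
`|∇h ^ (s / 2)|²`, so the energy of `h ^ (s / 2)` is bounded by the integral of `h`. The
Gagliardo-Nirenberg-Sobolev inequality bounds `h` in `L^p` with `p = s n / (n - 2)`, that is, for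
every `p < n / (n - 2)`. Applied to mollifications of `u`, this gives `u ∈ L^p_loc`
(`WeaklySuperharmonicOn.memLp_of_lt`), without any potential theory.

*The distribution on `Γ`.* By nonnegativity, `|⟨-Δu, φ⟩| ≤ A sup_Γ |φ|`
(`WeaklySuperharmonicOn.exists_abs_integral_le`), and the supremum is bounded by the norm of `(φ,
φ')` in `L²(Γ) × L²(Γ)`. The Hahn-Banach and Riesz theorems write the functional as `∫_Γ (w₀ φ -
w₁ φ')` with `w₀, w₁ ∈ L²(Γ)`, and `L²(Γ) ⊆ L^p(Γ)` because `p < n / (n - 2) ≤ 2`. The term `w₂`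
is zero.
-/

open Filter Topology

/-! ### Calculus of the Laplacian -/

section Calculus

variable {E : Type*} [NormedAddCommGroup E] [InnerProductSpace ℝ E]

theorem ContDiff.fderiv_apply_const {f : E → ℝ} {m n : WithTop ℕ∞} (hf : ContDiff ℝ n f)
    (hmn : m + 1 ≤ n) (v : E) : ContDiff ℝ m (fun y => fderiv ℝ f y v) :=
  (hf.fderiv_right hmn).clm_apply contDiff_const

theorem fderiv_comp_real {f : E → ℝ} {H : ℝ → ℝ} {c : ℝ} {x : E} (hf : DifferentiableAt ℝ f x)
    (hH : HasDerivAt H c (f x)) (v : E) :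
    fderiv ℝ (fun y => H (f y)) x v = c * fderiv ℝ f x v := by
  have := (hH.comp_hasFDerivAt x hf.hasFDerivAt).fderiv
  rw [show (fun y => H (f y)) = H ∘ f from rfl, this]
  simp

theorem fderiv_comp_const_sub_apply {f : E → ℝ} (hf : Differentiable ℝ f) (x y v : E) :
    fderiv ℝ (fun z => f (x - z)) y v = -fderiv ℝ f (x - y) v := by
  have h : HasFDerivAt (fun z => f (x - z))
      ((fderiv ℝ f (x - y)).comp (-ContinuousLinearMap.id ℝ E)) y :=
    (hf (x - y)).hasFDerivAt.comp y ((hasFDerivAt_id y).const_sub x)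
  simp [h.fderiv]

variable [FiniteDimensional ℝ E]

/-- The dot product `∇f · ∇g`, written in coordinates. -/
noncomputable def gradDot (f g : E → ℝ) (x : E) : ℝ :=
  ∑ i, fderiv ℝ f x (stdOrthonormalBasis ℝ E i) * fderiv ℝ g x (stdOrthonormalBasis ℝ E i)

theorem gradDot_self_nonneg (f : E → ℝ) (x : E) : 0 ≤ gradDot f f x :=
  Finset.sum_nonneg fun _ _ => mul_self_nonneg _

theorem two_mul_abs_gradDot_le (f g : E → ℝ) (x : E) :
    |2 * gradDot f g x| ≤ gradDot f f x + gradDot g g x := by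
  simp only [gradDot, Finset.mul_sum, ← Finset.sum_add_distrib]
  refine (Finset.abs_sum_le_sum_abs _ _).trans (Finset.sum_le_sum fun i _ => ?_)
  set a := fderiv ℝ f x (stdOrthonormalBasis ℝ E i)
  set b := fderiv ℝ g x (stdOrthonormalBasis ℝ E i)
  rw [abs_le]
  constructor <;> nlinarith [sq_nonneg (a - b), sq_nonneg (a + b)]

theorem gradDot_eq_zero_of_right (f : E → ℝ) {g : E → ℝ} {x : E} (h : gradDot g g x = 0) :
    gradDot f g x = 0 := by
  have h0 := (Finset.sum_eq_zero_iff_of_nonneg fun _ _ => mul_self_nonneg _).mp h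
  refine Finset.sum_eq_zero fun i hi => ?_
  rw [mul_self_eq_zero.mp (h0 i hi), mul_zero]

theorem laplacian_eq_sum_fderiv {f : E → ℝ} (hf : ContDiff ℝ 2 f) (x : E) :
    Δ f x = ∑ i, fderiv ℝ (fun y => fderiv ℝ f y (stdOrthonormalBasis ℝ E i)) x
      (stdOrthonormalBasis ℝ E i) := by
  rw [InnerProductSpace.laplacian_eq_iteratedFDeriv_stdOrthonormalBasis]
  refine Finset.sum_congr rfl fun i _ => ?_
  have hd : DifferentiableAt ℝ (fderiv ℝ f) x :=
    ((hf.fderiv_right (m := 1) (by norm_num)).differentiable (by norm_num)) x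
  rw [iteratedFDeriv_two_apply, fderiv_clm_apply hd (differentiableAt_const _)]
  simp

theorem ContDiff.continuous_laplacian {f : E → ℝ} (hf : ContDiff ℝ 2 f) : Continuous (Δ f) := by
  rw [show Δ f = fun x => _ from funext (laplacian_eq_sum_fderiv hf)]
  refine continuous_finsetSum _ fun i _ => ?_
  exact ((hf.fderiv_apply_const (m := 1) (by norm_num) _).fderiv_apply_const (m := 0)
    (by norm_num) _).continuous

theorem continuous_gradDot {f g : E → ℝ} (hf : ContDiff ℝ 1 f) (hg : ContDiff ℝ 1 g) :
    Continuous (gradDot f g) :=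
  continuous_finsetSum _ fun _ _ => (hf.fderiv_apply_const (m := 0) (by norm_num) _).continuous.mul
    (hg.fderiv_apply_const (m := 0) (by norm_num) _).continuous

theorem laplacian_mul {f g : E → ℝ} (hf : ContDiff ℝ 2 f) (hg : ContDiff ℝ 2 g) (x : E) :
    Δ (fun y => f y * g y) x = f x * Δ g x + g x * Δ f x + 2 * gradDot f g x := by
  rw [laplacian_eq_sum_fderiv (hf.mul hg), laplacian_eq_sum_fderiv hf, laplacian_eq_sum_fderiv hg,
    gradDot, Finset.mul_sum, Finset.mul_sum, Finset.mul_sum, ← Finset.sum_add_distrib,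
    ← Finset.sum_add_distrib]
  refine Finset.sum_congr rfl fun i _ => ?_
  set v := stdOrthonormalBasis ℝ E i
  have df : Differentiable ℝ f := hf.differentiable (by norm_num)
  have dg : Differentiable ℝ g := hg.differentiable (by norm_num)
  have df' : Differentiable ℝ (fun y => fderiv ℝ f y v) :=
    (hf.fderiv_apply_const (m := 1) (by norm_num) v).differentiable (by norm_num)
  have dg' : Differentiable ℝ (fun y => fderiv ℝ g y v) :=
    (hg.fderiv_apply_const (m := 1) (by norm_num) v).differentiable (by norm_num)
  have h1 : (fun y => fderiv ℝ (fun y => f y * g y) y v) =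
      fun y => f y * fderiv ℝ g y v + g y * fderiv ℝ f y v := by
    funext y
    rw [fderiv_fun_mul (df y) (dg y)]
    simp
  rw [h1, fderiv_fun_add ((df x).fun_mul (dg' x)) ((dg x).fun_mul (df' x)),
    fderiv_fun_mul (df x) (dg' x), fderiv_fun_mul (dg x) (df' x)]
  simp
  ring

theorem gradDot_comp_real {f : E → ℝ} {H : ℝ → ℝ} {c : ℝ} {x : E} (hf : DifferentiableAt ℝ f x)
    (hH : HasDerivAt H c (f x)) :
    gradDot (fun y => H (f y)) (fun y => H (f y)) x = c ^ 2 * gradDot f f x := by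
  simp only [gradDot, fderiv_comp_real hf hH, Finset.mul_sum]
  exact Finset.sum_congr rfl fun i _ => by ring

theorem laplacian_comp_real {f : E → ℝ} {H H' H'' : ℝ → ℝ} (hf : ContDiff ℝ 2 f)
    (hHf : ContDiff ℝ 2 fun y => H (f y)) (hH : ∀ y, HasDerivAt H (H' (f y)) (f y))
    (hH' : ∀ y, HasDerivAt H' (H'' (f y)) (f y)) (x : E) :
    Δ (fun y => H (f y)) x = H'' (f x) * gradDot f f x + H' (f x) * Δ f x := by
  have df : Differentiable ℝ f := hf.differentiable (by norm_num)
  rw [laplacian_eq_sum_fderiv hHf, laplacian_eq_sum_fderiv hf, gradDot, Finset.mul_sum,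
    Finset.mul_sum, ← Finset.sum_add_distrib]
  refine Finset.sum_congr rfl fun i _ => ?_
  set v := stdOrthonormalBasis ℝ E i
  have df' : Differentiable ℝ (fun y => fderiv ℝ f y v) :=
    (hf.fderiv_apply_const (m := 1) (by norm_num) v).differentiable (by norm_num)
  have h1 : (fun y => fderiv ℝ (fun y => H (f y)) y v) = fun y => H' (f y) * fderiv ℝ f y v :=
    funext fun y => fderiv_comp_real (df y) (hH y) v
  have h2 : DifferentiableAt ℝ (fun y => H' (f y)) x :=
    ((hH' x).comp_hasFDerivAt x (df x).hasFDerivAt).differentiableAt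
  rw [h1, fderiv_fun_mul h2 (df' x)]
  simp [fderiv_comp_real (df x) (hH' x)]
  ring

theorem laplacian_eq_zero_of_notMem_tsupport {f : E → ℝ} {x : E} (hx : x ∉ tsupport f) :
    Δ f x = 0 := by
  have h : f =ᶠ[𝓝 x] fun _ => 0 := notMem_tsupport_iff_eventuallyEq.mp hx
  rw [(InnerProductSpace.laplacian_congr_nhds h).eq_of_nhds]
  simp

theorem HasCompactSupport.laplacian {f : E → ℝ} (hf : HasCompactSupport f) :
    HasCompactSupport (Δ f) :=
  HasCompactSupport.intro' hf (isClosed_tsupport f) fun _ => laplacian_eq_zero_of_notMem_tsupport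

theorem exists_bound_laplacian {f : E → ℝ} (hf : ContDiff ℝ 2 f) (hc : HasCompactSupport f) :
    ∃ C, ∀ x, |Δ f x| ≤ C :=
  hf.continuous_laplacian.bounded_above_of_compact_support hc.laplacian

theorem laplacian_comp_const_sub {f : E → ℝ} (hf : ContDiff ℝ 2 f) (x y : E) :
    Δ (fun z => f (x - z)) y = Δ f (x - y) := by
  rw [laplacian_eq_sum_fderiv hf, laplacian_eq_sum_fderiv (by fun_prop)]
  refine Finset.sum_congr rfl fun i _ => ?_
  simp only [fderiv_comp_const_sub_apply (hf.differentiable (by norm_num))]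
  rw [fderiv_fun_neg]
  simp [fderiv_comp_const_sub_apply ((hf.fderiv_apply_const (m := 1) (by norm_num)
    (stdOrthonormalBasis ℝ E i)).differentiable (by norm_num))]

variable [MeasurableSpace E] [BorelSpace E]

/-- Green's identity without boundary term. -/
theorem integral_mul_laplacian_comm {f φ : E → ℝ} (hf : ContDiff ℝ 2 f) (hφ : ContDiff ℝ 2 φ)
    (hc : HasCompactSupport φ) : ∫ x, f x * Δ φ x = ∫ x, Δ f x * φ x := by
  have key : ∀ v : E, ∫ x, f x * fderiv ℝ (fun y => fderiv ℝ φ y v) x v =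
      ∫ x, fderiv ℝ (fun y => fderiv ℝ f y v) x v * φ x := by
    intro v
    have cf' := hf.fderiv_apply_const (m := 1) (by norm_num) v
    have cφ' := hφ.fderiv_apply_const (m := 1) (by norm_num) v
    have cf'' := cf'.fderiv_apply_const (m := 0) (by norm_num) v
    have cφ'' := cφ'.fderiv_apply_const (m := 0) (by norm_num) v
    have hc' : HasCompactSupport fun y => fderiv ℝ φ y v := hc.fderiv_apply ℝ v
    have hc'' : HasCompactSupport fun x => fderiv ℝ (fun y => fderiv ℝ φ y v) x v :=
      hc'.fderiv_apply ℝ v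
    have i1 : Integrable fun x => f x * fderiv ℝ (fun y => fderiv ℝ φ y v) x v :=
      (hf.continuous.mul cφ''.continuous).integrable_of_hasCompactSupport hc''.mul_left
    have i2 : Integrable fun x => fderiv ℝ f x v * fderiv ℝ φ x v :=
      (cf'.continuous.mul cφ'.continuous).integrable_of_hasCompactSupport hc'.mul_left
    have i3 : Integrable fun x => f x * fderiv ℝ φ x v :=
      (hf.continuous.mul cφ'.continuous).integrable_of_hasCompactSupport hc'.mul_left
    have i4 : Integrable fun x => fderiv ℝ (fun y => fderiv ℝ f y v) x v * φ x :=
      (cf''.continuous.mul hφ.continuous).integrable_of_hasCompactSupport hc.mul_left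
    have i5 : Integrable fun x => fderiv ℝ f x v * φ x :=
      (cf'.continuous.mul hφ.continuous).integrable_of_hasCompactSupport hc.mul_left
    rw [integral_mul_fderiv_eq_neg_fderiv_mul_of_integrable i2 i1 i3
      (fun x _ => hf.differentiable (by norm_num) x)
      (fun x _ => cφ'.differentiable (by norm_num) x),
      integral_mul_fderiv_eq_neg_fderiv_mul_of_integrable i4 i2 i5
      (fun x _ => cf'.differentiable (by norm_num) x)
      (fun x _ => hφ.differentiable (by norm_num) x), neg_neg]
  have e1 : ∀ x, f x * Δ φ x = ∑ i, f x * fderiv ℝ (fun y => fderiv ℝ φ y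
      (stdOrthonormalBasis ℝ E i)) x (stdOrthonormalBasis ℝ E i) := fun x => by
    rw [laplacian_eq_sum_fderiv hφ, Finset.mul_sum]
  have e2 : ∀ x, Δ f x * φ x = ∑ i, fderiv ℝ (fun y => fderiv ℝ f y
      (stdOrthonormalBasis ℝ E i)) x (stdOrthonormalBasis ℝ E i) * φ x := fun x => by
    rw [laplacian_eq_sum_fderiv hf, Finset.sum_mul]
  simp only [e1, e2]
  rw [integral_finsetSum, integral_finsetSum]
  · exact Finset.sum_congr rfl fun i _ => key _
  · intro i _
    exact (((hf.fderiv_apply_const (m := 1) (by norm_num) _).fderiv_apply_const (m := 0)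
      (by norm_num) _).continuous.mul hφ.continuous).integrable_of_hasCompactSupport hc.mul_left
  · intro i _
    exact (hf.continuous.mul ((hφ.fderiv_apply_const (m := 1) (by norm_num) _).fderiv_apply_const
      (m := 0) (by norm_num) _).continuous).integrable_of_hasCompactSupport
      ((hc.fderiv_apply ℝ _).fderiv_apply ℝ _).mul_left

open scoped Convolution

theorem fderiv_convolution_left_apply {ρ g : E → ℝ} (hρ : ContDiff ℝ 1 ρ)
    (hc : HasCompactSupport ρ) (hg : Integrable g) (x v : E) :
    fderiv ℝ (ρ ⋆[ContinuousLinearMap.lsmul ℝ ℝ, volume] g) x v =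
      ((fun y => fderiv ℝ ρ y v) ⋆[ContinuousLinearMap.lsmul ℝ ℝ, volume] g) x := by
  rw [(hc.hasFDerivAt_convolution_left _ hρ hg.locallyIntegrable x).fderiv]
  unfold MeasureTheory.convolution
  rw [ContinuousLinearMap.integral_apply]
  · rfl
  · exact (hc.fderiv ℝ).convolutionExists_left _ (hρ.continuous_fderiv (by norm_num))
      hg.locallyIntegrable x

theorem laplacian_convolution_left {ρ g : E → ℝ} (hρ : ContDiff ℝ 2 ρ)
    (hc : HasCompactSupport ρ) (hg : Integrable g) (x : E) :
    Δ (ρ ⋆[ContinuousLinearMap.lsmul ℝ ℝ, volume] g) x = ∫ y, Δ ρ (x - y) * g y := by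
  rw [laplacian_eq_sum_fderiv (hc.contDiff_convolution_left _ hρ hg.locallyIntegrable)]
  have h1 : ∀ v : E, (fun y => fderiv ℝ (ρ ⋆[ContinuousLinearMap.lsmul ℝ ℝ, volume] g) y v) =
      ((fun y => fderiv ℝ ρ y v) ⋆[ContinuousLinearMap.lsmul ℝ ℝ, volume] g) := fun v =>
    funext fun y => fderiv_convolution_left_apply (hρ.of_le (by norm_num)) hc hg y v
  have h2 : ∀ v : E, fderiv ℝ (fun y => fderiv ℝ (ρ ⋆[ContinuousLinearMap.lsmul ℝ ℝ, volume] g) y v)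
      x v = ∫ y, fderiv ℝ (fun y => fderiv ℝ ρ y v) (x - y) v * g y := by
    intro v
    rw [h1, fderiv_convolution_left_apply (hρ.fderiv_apply_const (by norm_num) v)
      (hc.fderiv_apply ℝ v) hg, convolution_eq_swap]
    rfl
  simp only [h2]
  rw [← integral_finsetSum]
  · refine integral_congr_ae (Eventually.of_forall fun y => ?_)
    simp only
    rw [laplacian_eq_sum_fderiv hρ, Finset.sum_mul]
  · intro i _
    have c := ((hρ.fderiv_apply_const (m := 1) (by norm_num)
      (stdOrthonormalBasis ℝ E i)).fderiv_apply_const (m := 0)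
      (by norm_num) (stdOrthonormalBasis ℝ E i)).continuous
    obtain ⟨C, hC⟩ := c.bounded_above_of_compact_support ((hc.fderiv_apply ℝ _).fderiv_apply ℝ _)
    exact hg.bdd_mul (c.comp (by fun_prop : Continuous fun y => x - y)).aestronglyMeasurable
      (Eventually.of_forall fun y => hC _)

end Calculus

/-! ### Weakly superharmonic functions -/

section Superharmonic

variable {E : Type*} [NormedAddCommGroup E] [InnerProductSpace ℝ E] [FiniteDimensional ℝ E]

theorem exists_smooth_cutoff {K Ω : Set E} (hK : IsCompact K) (hΩ : IsOpen Ω) (hKΩ : K ⊆ Ω) :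
    ∃ χ : E → ℝ, ContDiff ℝ ∞ χ ∧ HasCompactSupport χ ∧ tsupport χ ⊆ Ω ∧
      (∀ᶠ x in 𝓝ˢ K, χ x = 1) ∧ ∀ x, 0 ≤ χ x ∧ χ x ≤ 1 := by
  obtain ⟨L, hL, hKL, hLΩ⟩ := exists_compact_between hK hΩ hKΩ
  obtain ⟨χ, h1, h0, h01⟩ := exists_contMDiffMap_one_nhds_of_subset_interior
    (n := (⊤ : ℕ∞)) (modelWithCornersSelf ℝ E) hK.isClosed hKL
  have hs : tsupport χ ⊆ L := closure_minimal
    (fun x hx => by by_contra h; exact hx (h0 x h)) hL.isClosed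
  exact ⟨χ, contMDiff_iff_contDiff.mp χ.contMDiff, hL.of_isClosed_subset (isClosed_tsupport _) hs,
    hs.trans hLΩ, h1, fun x => ⟨(h01 x).1, (h01 x).2⟩⟩

variable [MeasurableSpace E] [BorelSpace E]

/-- `-Δu ≥ 0` in the sense of distributions on `Ω`. The test functions are supported in `Ω`, so that
the integral over the whole space is the integral over `Ω`. -/
def WeaklySuperharmonicOn (u : E → ℝ) (Ω : Set E) : Prop :=
  ∀ φ : E → ℝ, ContDiff ℝ ∞ φ → HasCompactSupport φ → tsupport φ ⊆ Ω → (∀ x, 0 ≤ φ x) →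
    ∫ x, u x * Δ φ x ≤ 0

open scoped Convolution

/-- Mollification: the approximants are the convolutions of `u`, cut off outside a compact
neighbourhood of `K`, with bump functions of shrinking support. -/
theorem WeaklySuperharmonicOn.exists_smooth_approx {u : E → ℝ} {Ω K : Set E}
    (hu : WeaklySuperharmonicOn u Ω) (hΩ : IsOpen Ω) (hloc : LocallyIntegrableOn u Ω)
    (hpos : ∀ᵐ x ∂volume.restrict Ω, 0 ≤ u x) (hK : IsCompact K) (hKΩ : K ⊆ Ω) :
    ∃ (f : ℕ → E → ℝ) (C : ℝ), (∀ j, ContDiff ℝ ∞ (f j)) ∧ (∀ j x, 0 ≤ f j x) ∧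
      (∀ j, ∀ x ∈ K, Δ (f j) x ≤ 0) ∧ (∀ j, Integrable (f j)) ∧ (∀ j, ∫ x, f j x ≤ C) ∧
      ∀ᵐ x ∂volume.restrict K, Tendsto (fun j => f j x) atTop (𝓝 (u x)) := by
  obtain ⟨δ, hδ, hδΩ⟩ := hK.exists_cthickening_subset_open hΩ hKΩ
  set K' := Metric.cthickening δ K
  have hK' : IsCompact K' := hK.cthickening
  have hU : Integrable (K'.indicator u) :=
    (hloc.integrableOn_compact_subset hδΩ hK').integrable_indicator hK'.measurableSet
  have hU0 : ∀ᵐ x, 0 ≤ K'.indicator u x := by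
    filter_upwards [(ae_restrict_iff' hΩ.measurableSet).mp hpos] with x hx
    exact Set.indicator_apply_nonneg fun h => hx (hδΩ h)
  let ρ : ℕ → ContDiffBump (0 : E) := fun j =>
    ⟨δ / (2 * (j + 1)), δ / (j + 1), by positivity, by
      gcongr
      nlinarith [(Nat.cast_nonneg j : (0 : ℝ) ≤ j)]⟩
  have hρs : ∀ j x, x ∉ Metric.closedBall (0 : E) δ → x ∉ tsupport ((ρ j).normed volume) := by
    intro j x hx h
    rw [ContDiffBump.tsupport_normed_eq] at h
    refine hx (Metric.closedBall_subset_closedBall ?_ h)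
    exact div_le_self hδ.le (by simp)
  have hρ2 : ∀ j, ContDiff ℝ 2 ((ρ j).normed volume) := fun j =>
    ((ρ j).contDiff_normed (n := 2))
  refine ⟨fun j => (ρ j).normed volume ⋆[ContinuousLinearMap.lsmul ℝ ℝ, volume] K'.indicator u,
    ∫ x, K'.indicator u x, ?_, ?_, ?_, ?_, ?_, ?_⟩
  · exact fun j => (ρ j).hasCompactSupport_normed.contDiff_convolution_left _
      ((ρ j).contDiff_normed (n := ⊤)) hU.locallyIntegrable
  · intro j x
    beta_reduce
    rw [convolution_eq_swap]
    refine integral_nonneg_of_ae ?_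
    filter_upwards [hU0] with y hy
    exact mul_nonneg ((ρ j).nonneg_normed _) hy
  · intro j x hx
    rw [laplacian_convolution_left (hρ2 j) (ρ j).hasCompactSupport_normed hU]
    -- The mollifier centred at `x ∈ K` is an admissible test function.
    have hsub : tsupport (fun y => (ρ j).normed volume (x - y)) ⊆ Metric.closedBall x δ := by
      refine closure_minimal (fun y hy => ?_) Metric.isClosed_closedBall
      by_contra h
      refine hρs j (x - y) (fun h' => h ?_) (subset_tsupport _ hy)
      rwa [mem_closedBall_zero_iff, ← dist_eq_norm, dist_comm] at h'
    have hsub' : Metric.closedBall x δ ⊆ K' := Metric.closedBall_subset_cthickening hx δ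
    have key := hu (fun y => (ρ j).normed volume (x - y))
      (((ρ j).contDiff_normed (n := ⊤)).comp (contDiff_const.sub contDiff_id))
      ((isCompact_closedBall x δ).of_isClosed_subset (isClosed_tsupport _) hsub)
      (hsub.trans (hsub'.trans hδΩ)) (fun y => (ρ j).nonneg_normed _)
    refine le_of_eq_of_le (integral_congr_ae (Eventually.of_forall fun y => ?_)) key
    simp only [laplacian_comp_const_sub (hρ2 j)]
    by_cases hy : y ∈ K'
    · rw [Set.indicator_of_mem hy, mul_comm]
    · have : x - y ∉ tsupport ((ρ j).normed volume) := by
        refine hρs j _ fun h => hy (hsub' ?_)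
        rwa [mem_closedBall_zero_iff, ← dist_eq_norm, dist_comm] at h
      rw [laplacian_eq_zero_of_notMem_tsupport this]
      simp
  · exact fun j => (ρ j).integrable_normed.integrable_convolution _ hU
  · intro j
    rw [integral_convolution _ (ρ j).integrable_normed hU, (ρ j).integral_normed]
    simp
  · have h := ContDiffBump.ae_convolution_tendsto_right_of_locallyIntegrable (μ := volume)
      (φ := ρ) (l := atTop) (K := 2) ?_ (Eventually.of_forall fun j => ?_) hU.locallyIntegrable
    · rw [ae_restrict_iff' hK.measurableSet]
      filter_upwards [h] with x hx hxK
      rwa [Set.indicator_of_mem (Metric.self_subset_cthickening K hxK)] at hx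
    · have := tendsto_one_div_add_atTop_nhds_zero_nat (𝕜 := ℝ)
      simpa [ρ, div_eq_mul_inv] using this.const_mul δ
    · change δ / (j + 1) ≤ 2 * (δ / (2 * (j + 1)))
      apply le_of_eq
      field_simp

/-- The function `k t / (k + t)`. For `k > 0` it is concave and increasing in `t ≥ 0`, bounded by
`k`, and tends to `t` as `k → ∞`: a smooth substitute for the truncation `min t k`. -/
noncomputable def saturate (k t : ℝ) : ℝ := k - k ^ 2 / (k + t)

theorem saturate_eq {k t : ℝ} (hk : 0 < k) (ht : 0 ≤ t) : saturate k t = t * (k / (k + t)) := by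
  have : k + t ≠ 0 := by positivity
  unfold saturate
  field_simp
  ring

theorem saturate_nonneg {k t : ℝ} (hk : 0 < k) (ht : 0 ≤ t) : 0 ≤ saturate k t := by
  rw [saturate_eq hk ht]
  positivity

theorem saturate_le_left {k t : ℝ} (hk : 0 < k) (ht : 0 ≤ t) : saturate k t ≤ k :=
  sub_le_self _ (by positivity)

theorem saturate_le_right {k t : ℝ} (hk : 0 < k) (ht : 0 ≤ t) : saturate k t ≤ t := by
  rw [saturate_eq hk ht]
  exact mul_le_of_le_one_right ht (div_le_one_of_le₀ (by linarith) (by linarith))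

theorem tendsto_saturate {t : ℝ} (ht : 0 ≤ t) :
    Tendsto (fun j : ℕ => saturate (j + 1) t) atTop (𝓝 t) := by
  have h : Tendsto (fun j : ℕ => t - t ^ 2 * (1 / ((j : ℝ) + 1 + t))) atTop
      (𝓝 (t - t ^ 2 * 0)) := by
    refine tendsto_const_nhds.sub (Tendsto.const_mul _ ?_)
    simp only [one_div]
    refine Filter.Tendsto.inv_tendsto_atTop ?_
    exact tendsto_atTop_add_const_right _ _
      (tendsto_atTop_add_const_right _ _ tendsto_natCast_atTop_atTop)
  rw [mul_zero, sub_zero] at h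
  refine h.congr fun j => ?_
  have : (j : ℝ) + 1 + t ≠ 0 := by positivity
  unfold saturate
  field_simp
  ring

theorem hasDerivAt_saturate {k t : ℝ} (h : k + t ≠ 0) :
    HasDerivAt (saturate k) (k ^ 2 / (k + t) ^ 2) t := by
  have h1 := ((hasDerivAt_id t).const_add k).inv h
  have h2 := (h1.const_mul (k ^ 2)).const_sub k
  refine (h2.congr_deriv ?_)
  simp only [id]
  field_simp

theorem hasDerivAt_deriv_saturate {k t : ℝ} (h : k + t ≠ 0) :
    HasDerivAt (fun t => k ^ 2 / (k + t) ^ 2) (-(2 * k ^ 2 / (k + t) ^ 3)) t := by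
  have h1 := (((hasDerivAt_id t).const_add k).fun_pow 2).fun_inv (pow_ne_zero 2 h)
  have h2 := h1.const_mul (k ^ 2)
  refine (h2.congr_deriv ?_)
  simp only [id, Nat.cast_ofNat, Nat.add_one_sub_one, pow_one]
  field_simp

/-- Weak superharmonicity is preserved by concave increasing functions; here for `saturate k`. -/
theorem WeaklySuperharmonicOn.comp_saturate {u : E → ℝ} {Ω : Set E}
    (hu : WeaklySuperharmonicOn u Ω) (hΩ : IsOpen Ω) (hloc : LocallyIntegrableOn u Ω)
    (hpos : ∀ᵐ x ∂volume.restrict Ω, 0 ≤ u x) {k : ℝ} (hk : 0 < k) :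
    WeaklySuperharmonicOn (fun x => saturate k (u x)) Ω := by
  intro φ hφ hc hsupp hφ0
  have hφ2 : ContDiff ℝ 2 φ := hφ.of_le (by norm_cast)
  obtain ⟨f, C, hf, hf0, hfΔ, -, -, hlim⟩ := hu.exists_smooth_approx hΩ hloc hpos hc hsupp
  have hne : ∀ j x, k + f j x ≠ 0 := fun j x => by have := hf0 j x; positivity
  have hsm : ∀ j, ContDiff ℝ 2 fun x => saturate k (f j x) := fun j =>
    contDiff_const.sub (contDiff_const.div
      (contDiff_const.add ((hf j).of_le (by norm_cast))) (hne j))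
  have hle : ∀ j, ∫ x, saturate k (f j x) * Δ φ x ≤ 0 := by
    intro j
    rw [integral_mul_laplacian_comm (hsm j) hφ2 hc]
    refine integral_nonpos fun x => ?_
    by_cases hx : x ∈ tsupport φ
    · refine mul_nonpos_of_nonpos_of_nonneg ?_ (hφ0 x)
      rw [laplacian_comp_real (H := saturate k) (H' := fun t => k ^ 2 / (k + t) ^ 2)
        (H'' := fun t => -(2 * k ^ 2 / (k + t) ^ 3)) ((hf j).of_le (by norm_cast)) (hsm j)
        (fun y => hasDerivAt_saturate (hne j y)) (fun y => hasDerivAt_deriv_saturate (hne j y))]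
      have h1 := hf0 j x
      have h2 := gradDot_self_nonneg (f j) x
      have h3 : 0 ≤ k ^ 2 / (k + f j x) ^ 2 * -Δ (f j) x :=
        mul_nonneg (by positivity) (by linarith [hfΔ j x hx])
      have h4 : 0 ≤ 2 * k ^ 2 / (k + f j x) ^ 3 * gradDot (f j) (f j) x := by positivity
      linarith
    · simp [image_eq_zero_of_notMem_tsupport hx]
  refine le_of_tendsto' (tendsto_integral_of_dominated_convergence (fun x => k * |Δ φ x|)
    (fun j => ((hsm j).continuous.mul hφ2.continuous_laplacian).aestronglyMeasurable) ?_ ?_ ?_) hle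
  · exact ((hφ2.continuous_laplacian.integrable_of_hasCompactSupport hc.laplacian).abs).const_mul k
  · refine fun j => Eventually.of_forall fun x => ?_
    rw [Real.norm_eq_abs, Pi.mul_apply, abs_mul, abs_of_nonneg (saturate_nonneg hk (hf0 j x))]
    exact mul_le_mul_of_nonneg_right (saturate_le_left hk (hf0 j x)) (abs_nonneg _)
  · filter_upwards [(ae_restrict_iff' hc.measurableSet).mp hlim,
      (ae_restrict_iff' hΩ.measurableSet).mp hpos] with x hx hx0
    by_cases hxs : x ∈ tsupport φ
    · refine Tendsto.mul_const _ ?_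
      have hn : k + u x ≠ 0 := by have := hx0 (hsupp hxs); positivity
      exact (hasDerivAt_saturate hn).continuousAt.tendsto.comp (hx hxs)
    · simp [laplacian_eq_zero_of_notMem_tsupport hxs]

/-- A bounded weakly superharmonic function extends across a closed set which is negligible in
the sense that it admits cut-off functions `η j`, equal to one off `N j` on `K`, whose Laplacian and
squared gradient are bounded by `c j` and tend to zero in `L¹(K)`. -/
theorem WeaklySuperharmonicOn.of_cutoffs {w : E → ℝ} {Ω Γ : Set E} {M : ℝ}
    (hw : WeaklySuperharmonicOn w (Ω \ Γ)) (hwm : ∀ K ⊆ Ω, IsCompact K →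
      AEStronglyMeasurable w (volume.restrict K))
    (hwM : ∀ᵐ x ∂volume.restrict Ω, |w x| ≤ M) (hΩ : IsOpen Ω)
    (h : ∀ K ⊆ Ω, IsCompact K → ∃ (η : ℕ → E → ℝ) (N : ℕ → Set E) (c : ℕ → ℝ),
      (∀ j, ContDiff ℝ ∞ (η j)) ∧ (∀ j x, 0 ≤ η j x ∧ η j x ≤ 1) ∧
      (∀ j, Disjoint (tsupport (η j)) Γ) ∧ (∀ j, MeasurableSet (N j)) ∧
      (∀ j, ∀ x ∈ K, x ∉ N j → η j x = 1 ∧ gradDot (η j) (η j) x = 0 ∧ Δ (η j) x = 0) ∧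
      (∀ j, ∀ x ∈ K, gradDot (η j) (η j) x ≤ c j ∧ |Δ (η j) x| ≤ c j) ∧ (∀ j, 1 ≤ c j) ∧
      Tendsto (fun j => c j * volume.real (K ∩ N j)) atTop (𝓝 0)) :
    WeaklySuperharmonicOn w Ω := by
  intro φ hφ hc hsupp hφ0
  obtain ⟨η, N, c, hη, hη01, hηΓ, hN, hoff, hbd, hc1, hlim⟩ := h _ hsupp hc
  set K := tsupport φ
  have hφ2 : ContDiff ℝ 2 φ := hφ.of_le (by norm_cast)
  have hη2 : ∀ j, ContDiff ℝ 2 (η j) := fun j => (hη j).of_le (by norm_cast)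
  have hKm : MeasurableSet K := hc.measurableSet
  have hwK : ∀ᵐ x, x ∈ K → |w x| ≤ M := by
    filter_upwards [(ae_restrict_iff' hΩ.measurableSet).mp hwM] with x hx hxK using hx (hsupp hxK)
  have hint : ∀ g : E → ℝ, Continuous g → (∀ x ∉ K, g x = 0) →
      Integrable fun x => w x * g x := by
    intro g hg hg0
    have h1 : IntegrableOn g K := hg.continuousOn.integrableOn_compact hc
    have h2 : IntegrableOn (fun x => w x * g x) K :=
      h1.bdd_mul (hwm K hsupp hc) ((ae_restrict_iff' hKm).mpr hwK)
    refine (integrableOn_iff_integrable_of_support_subset fun x hx => ?_).mp h2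
    by_contra hxK
    exact hx (by simp [hg0 x hxK])
  obtain ⟨C₀, hC₀⟩ := hφ.continuous.bounded_above_of_compact_support hc
  obtain ⟨C₂, hC₂⟩ := exists_bound_laplacian hφ2 hc
  obtain ⟨C₁, hC₁⟩ := hc.exists_bound_of_continuousOn
    (continuous_gradDot (hφ2.of_le (by norm_num)) (hφ2.of_le (by norm_num))).continuousOn
  have hprod : ∀ j, ContDiff ℝ 2 fun y => φ y * η j y := fun j => hφ2.mul (hη2 j)
  have hts : ∀ j, tsupport (fun y => φ y * η j y) ⊆ K := fun j => tsupport_mul_subset_left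
  -- `Δφ` and `Δ(φ η)` differ only near `Γ`, by at most a multiple of `c j`.
  have hR : ∀ j x, |Δ φ x - Δ (fun y => φ y * η j y) x| ≤
      (K ∩ N j).indicator (fun _ => (|C₀| + |C₂| + |C₁| + 1) * c j) x := by
    intro j x
    by_cases hxK : x ∈ K
    · rw [laplacian_mul hφ2 (hη2 j)]
      have hcj := hc1 j
      by_cases hxN : x ∈ N j
      · rw [Set.indicator_of_mem (show x ∈ K ∩ N j from ⟨hxK, hxN⟩)]
        obtain ⟨b1, b2⟩ := hbd j x hxK
        have b3 := abs_le.mp (two_mul_abs_gradDot_le φ (η j) x)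
        have b4 : |φ x * Δ (η j) x| ≤ |C₀| * c j := by
          rw [abs_mul]
          exact mul_le_mul ((hC₀ x).trans (le_abs_self _)) b2 (abs_nonneg _) (abs_nonneg _)
        have b5 : |(1 - η j x) * Δ φ x| ≤ 1 * |C₂| := by
          rw [abs_mul]
          refine mul_le_mul ?_ ((hC₂ x).trans (le_abs_self _)) (abs_nonneg _) (by norm_num)
          rw [abs_of_nonneg (by linarith [(hη01 j x).2])]
          linarith [(hη01 j x).1]
        have b6 : gradDot φ φ x ≤ |C₁| := (le_abs_self _).trans ((hC₁ x hxK).trans (le_abs_self _))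
        have b7 : |C₂| ≤ |C₂| * c j := le_mul_of_one_le_right (abs_nonneg _) hcj
        have b8 : |C₁| ≤ |C₁| * c j := le_mul_of_one_le_right (abs_nonneg _) hcj
        rw [abs_le] at b4 b5 ⊢
        constructor <;> nlinarith [b4.1, b4.2, b5.1, b5.2, b3.1, b3.2]
      · obtain ⟨e1, e2, e3⟩ := hoff j x hxK hxN
        rw [Set.indicator_of_notMem fun h => hxN h.2, e1, e3, gradDot_eq_zero_of_right φ e2]
        simp
    · rw [Set.indicator_of_notMem fun h => hxK h.1, laplacian_eq_zero_of_notMem_tsupport hxK,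
        laplacian_eq_zero_of_notMem_tsupport fun h => hxK (hts j h)]
      simp
  have hfin : ∀ j, volume (K ∩ N j) ≠ ⊤ := fun j =>
    ((measure_mono Set.inter_subset_left).trans_lt hc.measure_lt_top).ne
  have hle : ∀ j, ∫ x, w x * Δ φ x ≤
      (M * (|C₀| + |C₂| + |C₁| + 1)) * (c j * volume.real (K ∩ N j)) := by
    intro j
    have hneg : ∫ x, w x * Δ (fun y => φ y * η j y) x ≤ 0 := by
      refine hw _ (hφ.mul (hη j)) (hc.mul_right) (fun x hx => ⟨hsupp (hts j hx), ?_⟩)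
        fun x => mul_nonneg (hφ0 x) (hη01 j x).1
      exact Set.disjoint_left.mp (hηΓ j) (tsupport_mul_subset_right hx)
    have i1 := hint _ hφ2.continuous_laplacian fun x => laplacian_eq_zero_of_notMem_tsupport
    have i2 := hint _ (hprod j).continuous_laplacian
      fun x hx => laplacian_eq_zero_of_notMem_tsupport fun h => hx (hts j h)
    have hsplit : ∫ x, w x * Δ φ x = (∫ x, w x * Δ (fun y => φ y * η j y) x) +
        ∫ x, (w x * Δ φ x - w x * Δ (fun y => φ y * η j y) x) := by
      rw [integral_sub i1 i2]
      ring
    have hrem : ∫ x, (w x * Δ φ x - w x * Δ (fun y => φ y * η j y) x) ≤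
        ∫ x, (K ∩ N j).indicator (fun _ => M * ((|C₀| + |C₂| + |C₁| + 1) * c j)) x := by
      refine integral_mono_ae (i1.sub i2)
        ((integrable_indicator_iff (hKm.inter (hN j))).mpr (integrableOn_const (hfin j))) ?_
      filter_upwards [hwK] with x hx
      rw [← mul_sub]
      have hRx := hR j x
      by_cases hxK : x ∈ K ∩ N j
      · rw [Set.indicator_of_mem hxK] at hRx ⊢
        refine (le_abs_self _).trans ?_
        rw [abs_mul]
        exact mul_le_mul (hx hxK.1) hRx (abs_nonneg _) ((abs_nonneg _).trans (hx hxK.1))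
      · rw [Set.indicator_of_notMem hxK] at hRx ⊢
        rw [abs_nonpos_iff.mp hRx, mul_zero]
    rw [integral_indicator (hKm.inter (hN j)), setIntegral_const, smul_eq_mul] at hrem
    linarith
  have := ge_of_tendsto' (hlim.const_mul (M * (|C₀| + |C₂| + |C₁| + 1))) hle
  rwa [mul_zero] at this

end Superharmonic

/-! ### Cut-off functions around the zero set of a map -/

section Cutoff

variable {E : Type*} [NormedAddCommGroup E] [InnerProductSpace ℝ E] [FiniteDimensional ℝ E]
  {F : Type*} [NormedAddCommGroup F] [InnerProductSpace ℝ F]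

/-- Since `∇‖Q‖² = 2 ⟨Q, DQ⟩`, the gradient of `‖Q‖²` is of the order of `‖Q‖`. -/
theorem exists_gradDot_normSq_le {Q : E → F} (hQ : ContDiff ℝ ∞ Q) {K : Set E}
    (hK : IsCompact K) : ∃ C, 0 ≤ C ∧ ∀ x ∈ K,
      gradDot (fun y => ‖Q y‖ ^ 2) (fun y => ‖Q y‖ ^ 2) x ≤ C * ‖Q x‖ ^ 2 := by
  obtain ⟨B, hB⟩ := hK.exists_bound_of_continuousOn
    (hQ.continuous_fderiv (by simp)).continuousOn
  refine ⟨Module.finrank ℝ E * (4 * B ^ 2), by positivity, fun x hx => ?_⟩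
  have hd : HasFDerivAt (fun y => ‖Q y‖ ^ 2) _ x :=
    (hQ.differentiable (by simp) x).hasFDerivAt.norm_sq
  have hterm : ∀ i, fderiv ℝ (fun y => ‖Q y‖ ^ 2) x (stdOrthonormalBasis ℝ E i) *
      fderiv ℝ (fun y => ‖Q y‖ ^ 2) x (stdOrthonormalBasis ℝ E i) ≤ 4 * B ^ 2 * ‖Q x‖ ^ 2 := by
    intro i
    have h1 : ‖fderiv ℝ Q x (stdOrthonormalBasis ℝ E i)‖ ≤ B := by
      refine ((fderiv ℝ Q x).le_opNorm _).trans ?_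
      rw [(stdOrthonormalBasis ℝ E).norm_eq_one, mul_one]
      exact hB x hx
    have h2 := abs_real_inner_le_norm (Q x) (fderiv ℝ Q x (stdOrthonormalBasis ℝ E i))
    have h3 : |inner ℝ (Q x) (fderiv ℝ Q x (stdOrthonormalBasis ℝ E i))| ≤ ‖Q x‖ * B :=
      h2.trans (by gcongr)
    have h4 := sq_le_sq' (abs_le.mp h3).1 (abs_le.mp h3).2
    rw [hd.fderiv]
    simp only [ContinuousLinearMap.comp_apply, smul_apply, innerSL_apply_apply,
      nsmul_eq_mul, Nat.cast_ofNat]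
    nlinarith
  refine (Finset.sum_le_sum fun i _ => hterm i).trans ?_
  simp [mul_assoc]

/-- Cut-off functions at scale `m ^ (-1/2)` around the zero set of a smooth map `Q`, obtained by
composing `m ‖Q‖²` with a smooth step function. -/
theorem exists_cutoff_zero_set {Q : E → F} (hQ : ContDiff ℝ ∞ Q) {K : Set E}
    (hK : IsCompact K) : ∃ C, 1 ≤ C ∧ ∀ m : ℝ, 1 ≤ m → ∃ η : E → ℝ,
      ContDiff ℝ ∞ η ∧ (∀ x, 0 ≤ η x ∧ η x ≤ 1) ∧ Disjoint (tsupport η) {x | Q x = 0} ∧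
      (∀ x, 2 < m * ‖Q x‖ ^ 2 → η x = 1 ∧ gradDot η η x = 0 ∧ Δ η x = 0) ∧
      ∀ x ∈ K, gradDot η η x ≤ C * m ∧ |Δ η x| ≤ C * m := by
  let H : ℝ → ℝ := fun t => Real.smoothTransition (t - 1)
  have hH : ContDiff ℝ ∞ H := Real.smoothTransition.contDiff.comp (contDiff_id.sub contDiff_const)
  have hH' : ContDiff ℝ ∞ (deriv H) := (contDiff_infty_iff_deriv.mp hH).2
  have hH'' : ContDiff ℝ ∞ (deriv (deriv H)) := (contDiff_infty_iff_deriv.mp hH').2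
  have hd : ContDiff ℝ ∞ fun y => ‖Q y‖ ^ 2 := hQ.norm_sq ℝ
  obtain ⟨C₁, hC₁, hgrad⟩ := exists_gradDot_normSq_le hQ hK
  obtain ⟨C₂, hC₂⟩ := hK.exists_bound_of_continuousOn
    ((hd.of_le (by norm_cast) : ContDiff ℝ 2 _).continuous_laplacian).continuousOn
  obtain ⟨B₁, hB₁⟩ := (isCompact_Icc (a := (0 : ℝ)) (b := 2)).exists_bound_of_continuousOn
    hH'.continuous.continuousOn
  obtain ⟨B₂, hB₂⟩ := (isCompact_Icc (a := (0 : ℝ)) (b := 2)).exists_bound_of_continuousOn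
    hH''.continuous.continuousOn
  have hB₁0 : 0 ≤ B₁ := (norm_nonneg _).trans (hB₁ 0 (by simp))
  have hB₂0 : 0 ≤ B₂ := (norm_nonneg _).trans (hB₂ 0 (by simp))
  refine ⟨1 + B₁ ^ 2 * (2 * C₁) + B₂ * (2 * C₁) + B₁ * |C₂|,
    by nlinarith [mul_nonneg (sq_nonneg B₁) hC₁, mul_nonneg hB₂0 hC₁,
      mul_nonneg hB₁0 (abs_nonneg C₂)], fun m hm => ?_⟩
  have hm0 : 0 < m := by linarith
  have hη : ContDiff ℝ ∞ fun y => H (m * ‖Q y‖ ^ 2) := hH.comp (contDiff_const.mul hd)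
  have hout : ∀ x, 2 < m * ‖Q x‖ ^ 2 → H (m * ‖Q x‖ ^ 2) = 1 ∧
      gradDot (fun y => H (m * ‖Q y‖ ^ 2)) (fun y => H (m * ‖Q y‖ ^ 2)) x = 0 ∧
      Δ (fun y => H (m * ‖Q y‖ ^ 2)) x = 0 := by
    intro x hx
    have hev : (fun y => H (m * ‖Q y‖ ^ 2)) =ᶠ[𝓝 x] fun _ => 1 := by
      have : ∀ᶠ y in 𝓝 x, 2 < m * ‖Q y‖ ^ 2 :=
        (continuous_const.mul hd.continuous).continuousAt.eventually (lt_mem_nhds hx)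
      filter_upwards [this] with y hy
      exact Real.smoothTransition.one_of_one_le (by linarith)
    refine ⟨hev.eq_of_nhds, ?_, ?_⟩
    · simp [gradDot, hev.fderiv_eq]
    · rw [(InnerProductSpace.laplacian_congr_nhds hev).eq_of_nhds]
      simp
  refine ⟨fun y => H (m * ‖Q y‖ ^ 2), hη,
    fun x => ⟨Real.smoothTransition.nonneg _, Real.smoothTransition.le_one _⟩, ?_, hout, ?_⟩
  · have hsub : tsupport (fun y => H (m * ‖Q y‖ ^ 2)) ⊆ {x | 1 ≤ m * ‖Q x‖ ^ 2} := by
      refine closure_minimal (fun x hx => ?_)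
        (isClosed_le continuous_const (continuous_const.mul hd.continuous))
      by_contra h
      exact hx (Real.smoothTransition.zero_of_nonpos (by simpa using (not_le.mp h).le))
    refine Set.disjoint_left.mpr fun x hx hx0 => ?_
    have h1 : 1 ≤ m * ‖Q x‖ ^ 2 := hsub hx
    have h2 : Q x = 0 := hx0
    rw [h2] at h1
    norm_num at h1
  · intro x hx
    have hH1 : ∀ t, HasDerivAt (fun t => H (m * t)) (m * deriv H (m * t)) t := fun t => by
      have := ((hH.differentiable (by simp) (m * t)).hasDerivAt.comp t
        ((hasDerivAt_id t).const_mul m))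
      exact this.congr_deriv (by ring)
    have hH2 : ∀ t, HasDerivAt (fun t => m * deriv H (m * t))
        (m ^ 2 * deriv (deriv H) (m * t)) t := fun t => by
      have := ((hH'.differentiable (by simp) (m * t)).hasDerivAt.comp t
        ((hasDerivAt_id t).const_mul m)).const_mul m
      exact this.congr_deriv (by ring)
    have t1 : 0 ≤ B₁ ^ 2 * (2 * C₁) * m := by positivity
    have t2 : 0 ≤ B₂ * (2 * C₁) * m := by positivity
    have t3 : 0 ≤ B₁ * |C₂| * m := by positivity
    by_cases hx2 : 2 < m * ‖Q x‖ ^ 2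
    · obtain ⟨-, e2, e3⟩ := hout x hx2
      rw [e2, e3, abs_zero]
      constructor <;> nlinarith
    · push Not at hx2
      have hmem : m * ‖Q x‖ ^ 2 ∈ Set.Icc (0 : ℝ) 2 := ⟨by positivity, hx2⟩
      have b1 := hB₁ _ hmem
      have b2 := hB₂ _ hmem
      rw [Real.norm_eq_abs] at b1 b2
      have g0 := gradDot_self_nonneg (fun y => ‖Q y‖ ^ 2) x
      have g1 := hgrad x hx
      set g := gradDot (fun y => ‖Q y‖ ^ 2) (fun y => ‖Q y‖ ^ 2) x
      have g2 : m ^ 2 * g ≤ 2 * C₁ * m := by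
        calc m ^ 2 * g ≤ m ^ 2 * (C₁ * ‖Q x‖ ^ 2) := by gcongr
          _ = C₁ * m * (m * ‖Q x‖ ^ 2) := by ring
          _ ≤ C₁ * m * 2 := by gcongr
          _ = 2 * C₁ * m := by ring
      have g3 : 0 ≤ m ^ 2 * g := by positivity
      constructor
      · rw [gradDot_comp_real (f := fun y => ‖Q y‖ ^ 2) (H := fun t => H (m * t))
          (hd.differentiable (by simp) x) (hH1 _)]
        have : (m * deriv H (m * ‖Q x‖ ^ 2)) ^ 2 * g ≤ B₁ ^ 2 * (2 * C₁ * m) := by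
          calc (m * deriv H (m * ‖Q x‖ ^ 2)) ^ 2 * g
              = |deriv H (m * ‖Q x‖ ^ 2)| ^ 2 * (m ^ 2 * g) := by rw [sq_abs]; ring
            _ ≤ B₁ ^ 2 * (2 * C₁ * m) := by gcongr
        nlinarith
      · rw [laplacian_comp_real (f := fun y => ‖Q y‖ ^ 2) (H := fun t => H (m * t))
          (H' := fun t => m * deriv H (m * t)) (H'' := fun t => m ^ 2 * deriv (deriv H) (m * t))
          (hd.of_le (by norm_cast)) (hη.of_le (by norm_cast)) (fun y => hH1 _) (fun y => hH2 _)]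
        have a1 : |m ^ 2 * deriv (deriv H) (m * ‖Q x‖ ^ 2) * g| ≤ B₂ * (2 * C₁ * m) := by
          calc |m ^ 2 * deriv (deriv H) (m * ‖Q x‖ ^ 2) * g|
              = |deriv (deriv H) (m * ‖Q x‖ ^ 2)| * (m ^ 2 * g) := by
                rw [abs_mul, abs_mul, abs_of_nonneg g0, abs_of_nonneg (sq_nonneg m)]; ring
            _ ≤ B₂ * (2 * C₁ * m) := by gcongr
        have a2 : |m * deriv H (m * ‖Q x‖ ^ 2) * Δ (fun y => ‖Q y‖ ^ 2) x| ≤ m * B₁ * |C₂| := by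
          rw [abs_mul, abs_mul, abs_of_pos hm0]
          have := (hC₂ x hx).trans (le_abs_self C₂)
          rw [Real.norm_eq_abs] at this
          gcongr
        refine (abs_add_le _ _).trans ?_
        nlinarith

end Cutoff

/-! ### Negligibility of the circle -/

section Circle

variable {n : ℕ}

/-- A smooth map whose zero set is the circle `Γ`. Its first two coordinates are both
`x₁² + x₂² - 1`, which makes it comparable with the distance to `Γ` coordinate by coordinate. -/
noncomputable def circleDefining (hn : 2 ≤ n) (x : EuclideanSpace ℝ (Fin n)) :
    EuclideanSpace ℝ (Fin n) :=
  WithLp.toLp 2 fun i =>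
    if i.val < 2 then x ⟨0, by omega⟩ ^ 2 + x ⟨1, by omega⟩ ^ 2 - 1 else x i

theorem contDiff_circleDefining (hn : 2 ≤ n) : ContDiff ℝ ∞ (circleDefining hn) := by
  rw [contDiff_euclidean]
  intro i
  by_cases h : i.val < 2
  · simp only [circleDefining, h, if_true]
    fun_prop
  · simp only [circleDefining, h, if_false]
    fun_prop

theorem circleDefining_eq_zero_iff (hn : 2 ≤ n) (x : EuclideanSpace ℝ (Fin n)) :
    circleDefining hn x = 0 ↔ x ∈ circleΓ hn := by
  constructor
  · intro h
    have hi : ∀ i, circleDefining hn x i = 0 := fun i => by rw [h]; rfl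
    refine ⟨?_, fun i hi2 => ?_⟩
    · have := hi ⟨0, by omega⟩
      simp only [circleDefining, Nat.ofNat_pos, if_true] at this
      linarith
    · have := hi i
      simpa only [circleDefining, not_lt.mpr hi2, if_false] using this
  · rintro ⟨h1, h2⟩
    ext i
    by_cases h : i.val < 2
    · simp only [circleDefining, h, if_true, h1, sub_self]
      rfl
    · simp only [circleDefining, h, if_false]
      exact h2 i (not_lt.mp h)

theorem norm_le_of_forall_abs_le {x y : EuclideanSpace ℝ (Fin n)} (h : ∀ i, |x i| ≤ |y i|) :
    ‖x‖ ≤ ‖y‖ := by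
  rw [EuclideanSpace.norm_eq, EuclideanSpace.norm_eq]
  refine Real.sqrt_le_sqrt (Finset.sum_le_sum fun i _ => ?_)
  simpa using sq_le_sq.mpr (h i)

theorem exists_norm_sub_circleVec_le (hn : 2 ≤ n) (x : EuclideanSpace ℝ (Fin n)) :
    ∃ θ ∈ Set.Icc (-Real.pi) Real.pi, ‖x - circleVec n θ‖ ≤ ‖circleDefining hn x‖ := by
  set z : ℂ := ⟨x ⟨0, by omega⟩, x ⟨1, by omega⟩⟩ with hz
  have h0 : ‖z‖ * Real.cos z.arg = x ⟨0, by omega⟩ := Complex.norm_mul_cos_arg z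
  have h1 : ‖z‖ * Real.sin z.arg = x ⟨1, by omega⟩ := Complex.norm_mul_sin_arg z
  have h2 : x ⟨0, by omega⟩ ^ 2 + x ⟨1, by omega⟩ ^ 2 - 1 = (‖z‖ - 1) * (‖z‖ + 1) := by
    rw [← h0, ← h1]
    linear_combination ‖z‖ ^ 2 * Real.sin_sq_add_cos_sq z.arg
  have key : ∀ c : ℝ, |c| ≤ 1 → |‖z‖ * c - c| ≤
      |x ⟨0, by omega⟩ ^ 2 + x ⟨1, by omega⟩ ^ 2 - 1| := by
    intro c hc
    rw [h2, show ‖z‖ * c - c = (‖z‖ - 1) * c by ring, abs_mul, abs_mul]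
    refine mul_le_mul_of_nonneg_left (hc.trans ?_) (abs_nonneg _)
    exact (by linarith [norm_nonneg z] : (1 : ℝ) ≤ ‖z‖ + 1).trans (le_abs_self _)
  refine ⟨z.arg, ⟨(Complex.neg_pi_lt_arg z).le, Complex.arg_le_pi z⟩,
    norm_le_of_forall_abs_le fun i => ?_⟩
  obtain ⟨i, hi⟩ := i
  rcases i with _ | _ | i
  · simpa [circleDefining, circleVec, h0] using key _ (Real.abs_cos_le_one z.arg)
  · simpa [circleDefining, circleVec, h1] using key _ (Real.abs_sin_le_one z.arg)
  · simp [circleDefining, circleVec]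

theorem norm_circleVec_sub_le (θ θ' : ℝ) :
    ‖circleVec n θ - circleVec n θ'‖ ≤ √n * |θ - θ'| := by
  have h : ∀ i, (circleVec n θ - circleVec n θ') i ^ 2 ≤ |θ - θ'| ^ 2 := by
    intro i
    rw [sq_le_sq, abs_abs]
    by_cases h0 : i.val = 0
    · simpa [circleVec, h0] using Real.abs_cos_sub_cos_le θ θ'
    · by_cases h1 : i.val = 1
      · simpa [circleVec, h1] using Real.abs_sin_sub_sin_le θ θ'
      · simp [circleVec, h0, h1]
  rw [EuclideanSpace.norm_eq, ← Real.sqrt_sq (abs_nonneg (θ - θ')), ← Real.sqrt_mul (by positivity)]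
  refine Real.sqrt_le_sqrt ?_
  calc ∑ i, ‖(circleVec n θ - circleVec n θ') i‖ ^ 2 ≤ ∑ _i : Fin n, |θ - θ'| ^ 2 :=
        Finset.sum_le_sum fun i _ => by simpa using h i
    _ = n * |θ - θ'| ^ 2 := by simp

/-- The tube of radius `r / j` around `Γ` has volume `O(j ^ (1 - n))`: it is covered by `j` balls
of radius `O(1 / j)`. -/
theorem exists_volume_tube_le (hn : 2 ≤ n) (r : ℝ) (hr : 0 ≤ r) : ∃ C, 0 ≤ C ∧ ∀ j : ℕ, 0 < j →
    volume.real {x | ‖circleDefining hn x‖ ≤ r / j} ≤ C * (j * (1 / (j : ℝ)) ^ n) ∧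
      volume {x | ‖circleDefining hn x‖ ≤ r / j} ≠ ⊤ := by
  set R := r + √n * (2 * Real.pi)
  have hR : 0 ≤ R := by have := Real.pi_pos; positivity
  refine ⟨2 * (R ^ n * volume.real (Metric.ball (0 : EuclideanSpace ℝ (Fin n)) 1)), by positivity,
    fun j hj => ?_⟩
  have hj' : (0 : ℝ) < j := by exact_mod_cast hj
  let θ : ℕ → ℝ := fun i => -Real.pi + 2 * Real.pi / j * i
  have hcover : {x | ‖circleDefining hn x‖ ≤ r / j} ⊆
      ⋃ i ∈ Finset.range (j + 1), Metric.closedBall (circleVec n (θ i)) (R / j) := by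
    intro x hx
    obtain ⟨t, ht, hxt⟩ := exists_norm_sub_circleVec_le hn x
    have hpi := Real.pi_pos
    set s := (t + Real.pi) * j / (2 * Real.pi) with hs
    have hs0 : 0 ≤ s := div_nonneg (mul_nonneg (by linarith [ht.1]) hj'.le) (by linarith)
    have hsj : s ≤ j := by
      rw [hs, div_le_iff₀ (by linarith)]
      nlinarith [ht.2]
    have hts : t = -Real.pi + 2 * Real.pi / j * s := by
      rw [hs]
      field_simp
      ring
    have hfl := Nat.floor_le hs0
    have hfl' := Nat.lt_floor_add_one s
    have hfj : ⌊s⌋₊ ≤ j := by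
      have : ((⌊s⌋₊ : ℕ) : ℝ) ≤ j := hfl.trans hsj
      exact_mod_cast this
    simp only [Set.mem_iUnion, Finset.mem_range]
    refine ⟨⌊s⌋₊, by omega, ?_⟩
    have hdist : |t - θ ⌊s⌋₊| ≤ 2 * Real.pi / j := by
      rw [hts, show -Real.pi + 2 * Real.pi / j * s - θ ⌊s⌋₊ = 2 * Real.pi / j * (s - ⌊s⌋₊) by
        simp only [θ]; ring, abs_mul, abs_of_pos (by positivity),
        abs_of_nonneg (by linarith)]
      exact mul_le_of_le_one_right (by positivity) (by linarith)
    rw [Metric.mem_closedBall, dist_eq_norm]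
    calc ‖x - circleVec n (θ ⌊s⌋₊)‖
        ≤ ‖x - circleVec n t‖ + ‖circleVec n t - circleVec n (θ ⌊s⌋₊)‖ :=
          norm_sub_le_norm_sub_add_norm_sub _ _ _
      _ ≤ r / j + √n * (2 * Real.pi / j) := by
          gcongr
          · exact hxt.trans hx
          · exact (norm_circleVec_sub_le _ _).trans (by gcongr)
      _ = R / j := by simp only [R]; ring
  have hfin : volume (⋃ i ∈ Finset.range (j + 1),
      Metric.closedBall (circleVec n (θ i)) (R / j)) ≠ ⊤ :=
    ((measure_biUnion_finset_le _ _).trans_lt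
      (ENNReal.sum_lt_top.mpr fun _ _ => measure_closedBall_lt_top)).ne
  refine ⟨?_, ((measure_mono hcover).trans_lt hfin.lt_top).ne⟩
  calc volume.real {x | ‖circleDefining hn x‖ ≤ r / j}
      ≤ volume.real (⋃ i ∈ Finset.range (j + 1),
          Metric.closedBall (circleVec n (θ i)) (R / j)) := measureReal_mono hcover hfin
    _ ≤ ∑ i ∈ Finset.range (j + 1), volume.real (Metric.closedBall (circleVec n (θ i)) (R / j)) :=
        measureReal_biUnion_finset_le _ _
    _ = (j + 1) * ((R / j) ^ n *
          volume.real (Metric.ball (0 : EuclideanSpace ℝ (Fin n)) 1)) := by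
        simp [Measure.addHaar_real_closedBall _ _ (div_nonneg hR hj'.le)]
    _ ≤ (2 * j) * ((R / j) ^ n *
          volume.real (Metric.ball (0 : EuclideanSpace ℝ (Fin n)) 1)) := by
        have : (1 : ℝ) ≤ j := by exact_mod_cast hj
        gcongr
        linarith
    _ = _ := by rw [div_eq_mul_one_div, mul_pow]; ring

/-- Capacity estimate: in dimension at least four, `Γ` admits the cut-off functions required to
extend bounded superharmonic functions, because a tube of radius `ε` has volume `o(ε²)`. -/
theorem exists_cutoffs_circle (hn2 : 2 ≤ n) (hn : 4 ≤ n) {K : Set (EuclideanSpace ℝ (Fin n))}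
    (hK : IsCompact K) :
    ∃ (η : ℕ → EuclideanSpace ℝ (Fin n) → ℝ) (N : ℕ → Set (EuclideanSpace ℝ (Fin n)))
      (c : ℕ → ℝ), (∀ j, ContDiff ℝ ∞ (η j)) ∧ (∀ j x, 0 ≤ η j x ∧ η j x ≤ 1) ∧
      (∀ j, Disjoint (tsupport (η j)) (circleΓ hn2)) ∧
      (∀ j, MeasurableSet (N j)) ∧
      (∀ j, ∀ x ∈ K, x ∉ N j → η j x = 1 ∧ gradDot (η j) (η j) x = 0 ∧ Δ (η j) x = 0) ∧
      (∀ j, ∀ x ∈ K, gradDot (η j) (η j) x ≤ c j ∧ |Δ (η j) x| ≤ c j) ∧ (∀ j, 1 ≤ c j) ∧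
      Tendsto (fun j => c j * volume.real (K ∩ N j)) atTop (𝓝 0) := by
  obtain ⟨C, hC, hcut⟩ := exists_cutoff_zero_set (contDiff_circleDefining hn2) hK
  obtain ⟨C', hC', htube⟩ := exists_volume_tube_le hn2 2 zero_le_two
  have hm : ∀ j : ℕ, (1 : ℝ) ≤ ((j + 1 : ℕ) : ℝ) ^ 2 := fun j =>
    one_le_pow₀ (by exact_mod_cast Nat.le_add_left 1 j)
  choose η h1 h2 h3 h4 h5 using fun j : ℕ => hcut (((j + 1 : ℕ) : ℝ) ^ 2) (hm j)
  refine ⟨η, fun j => {x | ‖circleDefining hn2 x‖ ≤ 2 / ((j + 1 : ℕ) : ℝ)},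
    fun j => C * ((j + 1 : ℕ) : ℝ) ^ 2, h1, h2, fun j => ?_, fun j => ?_, fun j x _ hx => ?_, h5,
    fun j => one_le_mul_of_one_le_of_one_le hC (hm j), ?_⟩
  · convert h3 j using 1
    ext x
    exact (circleDefining_eq_zero_iff hn2 x).symm
  · exact (isClosed_le (contDiff_circleDefining hn2).continuous.norm
      continuous_const).measurableSet
  · refine h4 j x ?_
    have hj : (0 : ℝ) < ((j + 1 : ℕ) : ℝ) := by positivity
    rw [Set.mem_ofPred_eq, not_le, div_lt_iff₀ hj] at hx
    nlinarith
  · have hbound : ∀ j : ℕ, C * ((j + 1 : ℕ) : ℝ) ^ 2 *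
        volume.real (K ∩ {x | ‖circleDefining hn2 x‖ ≤ 2 / ((j + 1 : ℕ) : ℝ)}) ≤
        C * C' * (1 / ((j : ℝ) + 1)) := by
      intro j
      obtain ⟨b1, b2⟩ := htube (j + 1) j.succ_pos
      have b3 := (measureReal_mono (s₁ := K ∩ _) Set.inter_subset_right b2).trans b1
      set t : ℝ := ((j + 1 : ℕ) : ℝ) with ht
      have ht1 : 1 ≤ t := by rw [ht]; exact_mod_cast Nat.le_add_left 1 j
      have htn : (1 / t) ^ n ≤ (1 / t) ^ 4 :=
        pow_le_pow_of_le_one (by positivity) (by rw [div_le_one (by linarith)]; exact ht1) hn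
      calc _ ≤ C * t ^ 2 * (C' * (t * (1 / t) ^ 4)) := by
            refine mul_le_mul_of_nonneg_left (b3.trans ?_) (by positivity)
            gcongr
        _ = C * C' * (1 / t) := by field_simp
        _ = _ := by rw [ht]; push_cast; rfl
    refine squeeze_zero (fun j => by positivity) hbound ?_
    simpa using tendsto_one_div_add_atTop_nhds_zero_nat.const_mul (C * C')

theorem volume_circleΓ (hn2 : 2 ≤ n) (hn : 3 ≤ n) : volume (circleΓ hn2) = 0 := by
  have hsub : circleΓ hn2 ⊆
      ((LinearMap.ker (EuclideanSpace.proj (𝕜 := ℝ) (⟨2, by omega⟩ : Fin n)).toLinearMap :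
        Submodule ℝ (EuclideanSpace ℝ (Fin n))) : Set (EuclideanSpace ℝ (Fin n))) :=
    fun x hx => by simpa using hx.2 ⟨2, by omega⟩ le_rfl
  refine measure_mono_null hsub (Measure.addHaar_submodule _ _ fun h => ?_)
  have : EuclideanSpace.single (⟨2, by omega⟩ : Fin n) (1 : ℝ) ∈
      LinearMap.ker (EuclideanSpace.proj (𝕜 := ℝ) (⟨2, by omega⟩ : Fin n)).toLinearMap := by
    rw [h]; trivial
  simp at this

end Circle

/-! ### Extension across the circle -/

section Extension

variable {E : Type*} [NormedAddCommGroup E] [InnerProductSpace ℝ E] [FiniteDimensional ℝ E]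

theorem laplacian_normSq (x : E) : Δ (fun y : E => ‖y‖ ^ 2) x = 2 * Module.finrank ℝ E := by
  rw [laplacian_eq_sum_fderiv (contDiff_norm_sq ℝ)]
  have h : ∀ v : E, (fun y : E => fderiv ℝ (fun y : E => ‖y‖ ^ 2) y v) =
      fun y => 2 * inner ℝ v y := by
    intro v
    funext y
    rw [(hasStrictFDerivAt_norm_sq y).hasFDerivAt.fderiv]
    simp [real_inner_comm]
  have h2 : ∀ v : E, fderiv ℝ (fun y : E => 2 * inner ℝ v y) x v = 2 * inner ℝ v v := by
    intro v
    have := ((innerSL ℝ v).hasFDerivAt (x := x)).const_mul 2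
    rw [show (fun y : E => 2 * inner ℝ v y) = fun y => 2 * innerSL ℝ v y from rfl, this.fderiv]
    simp
  simp only [h, h2]
  simp [mul_comm]

theorem memLp_of_tendsto_of_eLpNorm_le {α : Type*} [MeasurableSpace α] {μ : Measure α}
    {f : ℕ → α → ℝ} {g : α → ℝ} {p C : ENNReal} (hf : ∀ j, AEStronglyMeasurable (f j) μ)
    (hlim : ∀ᵐ x ∂μ, Tendsto (fun j => f j x) atTop (𝓝 (g x))) (hC : C ≠ ⊤)
    (hle : ∀ j, eLpNorm (f j) p μ ≤ C) : MemLp g p μ :=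
  ⟨aestronglyMeasurable_of_tendsto_ae atTop hf hlim,
    ((Lp.eLpNorm_lim_le_liminf_eLpNorm hf g hlim).trans
      (liminf_le_of_frequently_le' (Frequently.of_forall hle))).trans_lt hC.lt_top⟩

variable [MeasurableSpace E] [BorelSpace E]

theorem MeasureTheory.IntegrableOn.integrable_mul_of_eq_zero {w g : E → ℝ} {K : Set E}
    (hw : IntegrableOn w K) (hK : IsCompact K) (hg : Continuous g) (hg0 : ∀ x ∉ K, g x = 0) :
    Integrable fun x => w x * g x := by
  have h2 : IntegrableOn (fun x => w x * g x) K := hw.mul_continuousOn hg.continuousOn hK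
  refine (integrableOn_iff_integrable_of_support_subset fun x hx => ?_).mp h2
  by_contra hxK
  exact hx (by simp [hg0 x hxK])

theorem MeasureTheory.AEStronglyMeasurable.saturate {α : Type*} [MeasurableSpace α] {μ : Measure α}
    {u : α → ℝ} (hu : AEStronglyMeasurable u μ) (k : ℝ) :
    AEStronglyMeasurable (fun x => saturate k (u x)) μ :=
  ((measurable_const.sub
    (measurable_const.div (measurable_const.add measurable_id))).comp_aemeasurable
    hu.aemeasurable).aestronglyMeasurable

/-- If the saturations of `u ≥ 0` are weakly superharmonic on `Ω`, then so is `u`, as soon as it is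
locally integrable. -/
theorem WeaklySuperharmonicOn.of_saturate {u : E → ℝ} {Ω : Set E}
    (h : ∀ k : ℝ, 0 < k → WeaklySuperharmonicOn (fun x => saturate k (u x)) Ω) (hΩ : IsOpen Ω)
    (hloc : LocallyIntegrableOn u Ω) (hpos : ∀ᵐ x ∂volume.restrict Ω, 0 ≤ u x) :
    WeaklySuperharmonicOn u Ω := by
  intro φ hφ hc hsupp hφ0
  have hφ2 : ContDiff ℝ 2 φ := hφ.of_le (by norm_cast)
  have hcont := hφ2.continuous_laplacian
  have hint := (hloc.integrableOn_compact_subset hsupp hc).integrable_mul_of_eq_zero hc hcont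
    fun x => laplacian_eq_zero_of_notMem_tsupport
  have hpos' : ∀ᵐ x, x ∈ tsupport φ → 0 ≤ u x := by
    filter_upwards [(ae_restrict_iff' hΩ.measurableSet).mp hpos] with x hx hxs using hx (hsupp hxs)
  refine le_of_tendsto' (tendsto_integral_of_dominated_convergence (fun x => |u x * Δ φ x|)
    (fun j => ?_) hint.abs (fun j => ?_) ?_)
    (fun j : ℕ => h (j + 1) (by positivity) φ hφ hc hsupp hφ0)
  · have h1 : AEStronglyMeasurable (fun x => saturate (j + 1) (u x) * Δ φ x)
        (volume.restrict (tsupport φ)) :=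
      ((hloc.integrableOn_compact_subset hsupp hc).aestronglyMeasurable.saturate _).mul
        hcont.aestronglyMeasurable
    have h2 := (aestronglyMeasurable_indicator_iff hc.measurableSet).mpr h1
    refine h2.congr (Eventually.of_forall fun x => ?_)
    by_cases hx : x ∈ tsupport φ
    · exact Set.indicator_of_mem hx _
    · beta_reduce
      rw [Set.indicator_of_notMem hx, laplacian_eq_zero_of_notMem_tsupport hx, mul_zero]
  · filter_upwards [hpos'] with x hx
    by_cases hxs : x ∈ tsupport φ
    · have hj : (0 : ℝ) < j + 1 := by positivity
      rw [Real.norm_eq_abs, abs_mul, abs_mul, abs_of_nonneg (saturate_nonneg hj (hx hxs)),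
        abs_of_nonneg (hx hxs)]
      exact mul_le_mul_of_nonneg_right (saturate_le_right hj (hx hxs)) (abs_nonneg _)
    · simp [laplacian_eq_zero_of_notMem_tsupport hxs]
  · filter_upwards [hpos'] with x hx
    by_cases hxs : x ∈ tsupport φ
    · exact (tendsto_saturate (hx hxs)).mul_const _
    · simp [laplacian_eq_zero_of_notMem_tsupport hxs]

/-- A nonnegative function whose saturations are weakly superharmonic on the ball of radius two is
locally integrable there if it is so outside a set `Γ` contained in the unit ball: test with a
cut-off of `‖x‖²`, which is strictly subharmonic near `Γ`. -/
theorem locallyIntegrableOn_of_saturate [Nontrivial E] {u : E → ℝ} {Γ : Set E}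
    (hΓ : Γ ⊆ Metric.closedBall 0 1)
    (hum : AEStronglyMeasurable u (volume.restrict (Metric.ball 0 2)))
    (h : ∀ k : ℝ, 0 < k → WeaklySuperharmonicOn (fun x => saturate k (u x)) (Metric.ball 0 2))
    (hloc : LocallyIntegrableOn u (Metric.ball 0 2 \ Γ))
    (hpos : ∀ᵐ x ∂volume.restrict (Metric.ball (0 : E) 2), 0 ≤ u x) :
    LocallyIntegrableOn u (Metric.ball 0 2) := by
  have hout : ∀ K : Set E, K ⊆ Metric.ball 0 2 → IsCompact K →
      IntegrableOn u (K \ Metric.ball 0 (3 / 2)) := fun K hK hKc =>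
    hloc.integrableOn_compact_subset (fun x hx => ⟨hK hx.1, fun hxΓ => hx.2
      (Metric.closedBall_subset_ball (by norm_num) (hΓ hxΓ))⟩) (hKc.diff Metric.isOpen_ball)
  set A := Metric.closedBall (0 : E) (3 / 2)
  have hA : IsCompact A := isCompact_closedBall _ _
  have hA2 : A ⊆ Metric.ball 0 2 := Metric.closedBall_subset_ball (by norm_num)
  suffices hin : IntegrableOn u A by
    refine (locallyIntegrableOn_iff Metric.isOpen_ball.isLocallyClosed).mpr fun K hK hKc => ?_
    refine (hin.union (hout K hK hKc)).mono_set fun x hx => ?_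
    by_cases hxA : x ∈ Metric.ball (0 : E) (3 / 2)
    · exact Or.inl (Metric.ball_subset_closedBall hxA)
    · exact Or.inr ⟨hx, hxA⟩
  obtain ⟨χ, hχ, hχc, hχs, hχ1, hχ01⟩ := exists_smooth_cutoff hA Metric.isOpen_ball hA2
  set φ : E → ℝ := fun x => χ x * ‖x‖ ^ 2
  have hφ : ContDiff ℝ ∞ φ := hχ.mul (contDiff_norm_sq ℝ)
  have hφ2 : ContDiff ℝ 2 φ := hφ.of_le (by norm_cast)
  have hφc : HasCompactSupport φ := hχc.mul_right
  have hφs : tsupport φ ⊆ Metric.ball 0 2 := tsupport_mul_subset_left.trans hχs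
  have hφA : ∀ x ∈ A, Δ φ x = 2 * Module.finrank ℝ E := by
    intro x hx
    have hev : φ =ᶠ[𝓝 x] fun y => ‖y‖ ^ 2 := by
      filter_upwards [(eventually_nhdsSet_iff_forall.mp hχ1) x hx] with y hy
      simp [φ, hy]
    rw [(InnerProductSpace.laplacian_congr_nhds hev).eq_of_nhds, laplacian_normSq]
  obtain ⟨C, hC⟩ := exists_bound_laplacian hφ2 hφc
  have hC0 : 0 ≤ C := (abs_nonneg _).trans (hC 0)
  set S := tsupport φ \ Metric.ball 0 (3 / 2)
  have hS : IntegrableOn u S := hout _ hφs hφc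
  have hSm : MeasurableSet S := (isClosed_tsupport φ).measurableSet.diff measurableSet_ball
  have hpos' := (ae_restrict_iff' (measurableSet_ball (x := (0 : E)) (ε := 2))).mp hpos
  have hn : (0 : ℝ) < Module.finrank ℝ E := by exact_mod_cast Module.finrank_pos
  -- The subharmonic test function bounds the integrals over `A` uniformly in `k`.
  have hbound : ∀ k : ℝ, 0 < k → IntegrableOn (fun x => saturate k (u x)) A ∧
      ∫ x in A, saturate k (u x) ≤ C * (∫ x in S, |u x|) := by
    intro k hk
    have hkint : ∀ K ⊆ Metric.ball (0 : E) 2, IsCompact K →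
        IntegrableOn (fun x => saturate k (u x)) K := by
      intro K hK hKc
      have : IsFiniteMeasure (volume.restrict K) :=
        isFiniteMeasure_restrict.mpr hKc.measure_lt_top.ne
      refine Integrable.of_bound
        ((hum.mono_measure (Measure.restrict_mono hK le_rfl)).saturate k) k ?_
      rw [ae_restrict_iff' hKc.measurableSet]
      filter_upwards [hpos'] with x hx hxK
      rw [Real.norm_eq_abs, abs_of_nonneg (saturate_nonneg hk (hx (hK hxK)))]
      exact saturate_le_left hk (hx (hK hxK))
    refine ⟨hkint A hA2 hA, ?_⟩
    have i1 : Integrable (A.indicator fun x => saturate k (u x)) :=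
      (hkint A hA2 hA).integrable_indicator hA.measurableSet
    have i2 : Integrable (S.indicator fun x => C * |u x|) :=
      IntegrableOn.integrable_indicator (hS.abs.const_mul C) hSm
    have i3 : Integrable fun x => saturate k (u x) * Δ φ x :=
      (hkint _ hφs hφc).integrable_mul_of_eq_zero hφc hφ2.continuous_laplacian
        fun x => laplacian_eq_zero_of_notMem_tsupport
    have key : ∫ x, A.indicator (fun x => saturate k (u x)) x ≤
        ∫ x, (saturate k (u x) * Δ φ x + S.indicator (fun x => C * |u x|) x) := by
      refine integral_mono_ae i1 (i3.add i2) ?_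
      filter_upwards [hpos'] with x hx
      by_cases hx2 : x ∈ Metric.ball (0 : E) 2
      · have h0 := saturate_nonneg hk (hx hx2)
        have h1 := saturate_le_right hk (hx hx2)
        have hS0 : 0 ≤ S.indicator (fun x => C * |u x|) x :=
          Set.indicator_nonneg (fun y _ => by positivity) x
        by_cases hxA : x ∈ A
        · rw [Set.indicator_of_mem hxA, hφA x hxA]
          have : (1 : ℝ) ≤ Module.finrank ℝ E := by exact_mod_cast Module.finrank_pos
          nlinarith
        · rw [Set.indicator_of_notMem hxA]
          by_cases hxs : x ∈ tsupport φ
          · rw [Set.indicator_of_mem (show x ∈ S from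
              ⟨hxs, fun h => hxA (Metric.ball_subset_closedBall h)⟩)]
            have h3 := (abs_le.mp (hC x)).1
            have h4 := le_abs_self (u x)
            nlinarith
          · rw [laplacian_eq_zero_of_notMem_tsupport hxs]
            linarith
      · rw [Set.indicator_of_notMem fun h => hx2 (hA2 h),
          Set.indicator_of_notMem fun h => hx2 (hφs h.1),
          laplacian_eq_zero_of_notMem_tsupport fun h => hx2 (hφs h)]
        simp
    rw [integral_add i3 i2, integral_indicator hA.measurableSet, integral_indicator hSm,
      integral_const_mul] at key
    have := h k hk φ hφ hφc hφs fun x => mul_nonneg (hχ01 x).1 (sq_nonneg _)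
    linarith
  have hposA : ∀ᵐ x ∂volume.restrict A, 0 ≤ u x := by
    rw [ae_restrict_iff' hA.measurableSet]
    filter_upwards [hpos'] with x hx hxA using hx (hA2 hxA)
  rw [IntegrableOn, ← memLp_one_iff_integrable]
  refine memLp_of_tendsto_of_eLpNorm_le (C := ENNReal.ofReal (C * ∫ x in S, |u x|))
    (fun j : ℕ => (hbound (j + 1) (by positivity)).1.aestronglyMeasurable)
    (hposA.mono fun x hx => tendsto_saturate hx) ENNReal.ofReal_ne_top fun j => ?_
  obtain ⟨b1, b2⟩ := hbound (j + 1) (by positivity)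
  rw [eLpNorm_one_eq_lintegral_enorm, ← ofReal_integral_norm_eq_lintegral_enorm b1]
  refine ENNReal.ofReal_le_ofReal (le_of_eq_of_le (integral_congr_ae ?_) b2)
  filter_upwards [hposA] with x hx
  rw [Real.norm_eq_abs, abs_of_nonneg (saturate_nonneg (by positivity) hx)]

end Extension

/-! ### Local integrability of superharmonic functions -/

section Integrability

variable {E : Type*} [NormedAddCommGroup E] [InnerProductSpace ℝ E] [FiniteDimensional ℝ E]

theorem sq_norm_fderiv_eq_gradDot (f : E → ℝ) (x : E) : ‖fderiv ℝ f x‖ ^ 2 = gradDot f f x := by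
  set L := (InnerProductSpace.toDual ℝ E).symm (fderiv ℝ f x) with hL
  have h1 : ‖fderiv ℝ f x‖ = ‖L‖ := ((InnerProductSpace.toDual ℝ E).symm.norm_map _).symm
  rw [h1, ← (stdOrthonormalBasis ℝ E).sum_sq_norm_inner_right L, gradDot]
  refine Finset.sum_congr rfl fun i _ => ?_
  rw [real_inner_comm, hL, InnerProductSpace.toDual_symm_apply, Real.norm_eq_abs, sq_abs, sq]

theorem gradDot_mul_self_le {f g : E → ℝ} {x : E} (hf : DifferentiableAt ℝ f x)
    (hg : DifferentiableAt ℝ g x) :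
    gradDot (fun y => f y * g y) (fun y => f y * g y) x ≤
      2 * (f x ^ 2 * gradDot g g x) + 2 * (g x ^ 2 * gradDot f f x) := by
  simp only [gradDot, Finset.mul_sum, ← Finset.sum_add_distrib]
  refine Finset.sum_le_sum fun i _ => ?_
  rw [fderiv_fun_mul hf hg]
  simp only [add_apply, smul_apply, smul_eq_mul]
  set a := f x * fderiv ℝ g x (stdOrthonormalBasis ℝ E i)
  set b := g x * fderiv ℝ f x (stdOrthonormalBasis ℝ E i)
  nlinarith [sq_nonneg (a - b)]

variable [MeasurableSpace E] [BorelSpace E]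

/-- Caccioppoli estimate: a power `h ^ s` with `0 < s < 1` of a positive superharmonic function is
strictly superharmonic to the extent that it controls the energy of `h ^ (s / 2)`. -/
theorem integral_sq_mul_gradDot_rpow_le {h χ : E → ℝ} {s B : ℝ} (hh : ContDiff ℝ ∞ h)
    (h1 : ∀ x, 1 ≤ h x) (hχ : ContDiff ℝ ∞ χ) (hχc : HasCompactSupport χ)
    (hΔ : ∀ x ∈ tsupport χ, Δ h x ≤ 0) (hs0 : 0 < s) (hs1 : s < 1)
    (hB : ∀ x, |Δ (fun y => χ y ^ 2) x| ≤ B) :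
    ∫ x, χ x ^ 2 * gradDot (fun y => h y ^ (s / 2)) (fun y => h y ^ (s / 2)) x ≤
      s / (4 * (1 - s)) * (B * ∫ x in tsupport χ, h x) := by
  have hpos : ∀ x, 0 < h x := fun x => lt_of_lt_of_le one_pos (h1 x)
  have hh2 : ContDiff ℝ 2 h := hh.of_le (by norm_cast)
  have hhs : ∀ r : ℝ, ContDiff ℝ 2 fun y => h y ^ r := fun r =>
    hh2.rpow_const_of_ne fun x => (hpos x).ne'
  have hχ2 : ContDiff ℝ 2 fun y => χ y ^ 2 := (hχ.of_le (by norm_cast)).pow 2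
  have hχ2s : tsupport (fun y => χ y ^ 2) ⊆ tsupport χ := by
    refine closure_mono fun x hx hx0 => hx ?_
    simp [hx0]
  have hχ2c : HasCompactSupport fun y => χ y ^ 2 :=
    hχc.of_isClosed_subset (isClosed_tsupport _) hχ2s
  have hder : ∀ (r : ℝ) (x : E), HasDerivAt (fun t : ℝ => t ^ r) (r * h x ^ (r - 1)) (h x) :=
    fun r x => Real.hasDerivAt_rpow_const (Or.inl (hpos x).ne')
  -- The pointwise inequality `χ² |∇h^(s/2)|² ≤ -s / (4 (1 - s)) χ² Δ(h^s)`.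
  have hpt : ∀ x, χ x ^ 2 * gradDot (fun y => h y ^ (s / 2)) (fun y => h y ^ (s / 2)) x ≤
      s / (4 * (1 - s)) * -(Δ (fun y => h y ^ s) x * χ x ^ 2) := by
    intro x
    by_cases hx : x ∈ tsupport χ
    · rw [gradDot_comp_real (hh2.differentiable (by norm_num) x) (hder (s / 2) x),
        laplacian_comp_real (H := fun t => t ^ s) (H' := fun t => s * t ^ (s - 1))
          (H'' := fun t => s * ((s - 1) * t ^ (s - 1 - 1))) hh2 (hhs s) (fun y => hder s y)
          (fun y => (hder (s - 1) y).const_mul s)]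
      have e1 : (h x ^ (s / 2 - 1)) ^ 2 = h x ^ (s - 1 - 1) := by
        rw [← Real.rpow_natCast, ← Real.rpow_mul (hpos x).le]
        congr 1
        push_cast
        ring
      have e2 : 0 ≤ s / (4 * (1 - s)) * (s * h x ^ (s - 1) * -Δ h x * χ x ^ 2) := by
        have := hΔ x hx
        have h3 : 0 ≤ h x ^ (s - 1) := (Real.rpow_pos_of_pos (hpos x) _).le
        have h4 : 0 < 1 - s := by linarith
        have h5 : 0 ≤ -Δ h x := by linarith
        positivity
      have e3 : 1 - s ≠ 0 := by linarith
      have e4 : s / (4 * (1 - s)) * (s * (1 - s)) = (s / 2) ^ 2 := by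
        field_simp
        ring
      rw [mul_pow, e1]
      have e5 : s / (4 * (1 - s)) * -((s * ((s - 1) * h x ^ (s - 1 - 1)) * gradDot h h x +
          s * h x ^ (s - 1) * Δ h x) * χ x ^ 2) =
          s / (4 * (1 - s)) * (s * (1 - s)) * (h x ^ (s - 1 - 1) * gradDot h h x * χ x ^ 2) +
          s / (4 * (1 - s)) * (s * h x ^ (s - 1) * -Δ h x * χ x ^ 2) := by ring
      rw [e5, e4]
      nlinarith
    · simp [image_eq_zero_of_notMem_tsupport hx]
  have hgc : Continuous (gradDot (fun y => h y ^ (s / 2)) fun y => h y ^ (s / 2)) :=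
    continuous_gradDot ((hhs _).of_le (by norm_num)) ((hhs _).of_le (by norm_num))
  have i1 : Integrable fun x =>
      χ x ^ 2 * gradDot (fun y => h y ^ (s / 2)) (fun y => h y ^ (s / 2)) x :=
    (hχ2.continuous.mul hgc).integrable_of_hasCompactSupport hχ2c.mul_right
  have i2 : Integrable fun x => Δ (fun y => h y ^ s) x * χ x ^ 2 :=
    ((hhs s).continuous_laplacian.mul hχ2.continuous).integrable_of_hasCompactSupport hχ2c.mul_left
  have i3 : Integrable fun x => h x ^ s * Δ (fun y => χ y ^ 2) x :=
    ((hhs s).continuous.mul hχ2.continuous_laplacian).integrable_of_hasCompactSupport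
      hχ2c.laplacian.mul_left
  have i4 : IntegrableOn h (tsupport χ) := hh.continuous.continuousOn.integrableOn_compact hχc
  have hTm : MeasurableSet (tsupport χ) := (isClosed_tsupport χ).measurableSet
  refine (integral_mono i1 (i2.neg.const_mul _) hpt).trans ?_
  rw [integral_const_mul]
  have hs' : 0 ≤ s / (4 * (1 - s)) := div_nonneg hs0.le (by linarith)
  refine mul_le_mul_of_nonneg_left ?_ hs'
  rw [integral_neg', ← integral_mul_laplacian_comm (hhs s) hχ2 hχ2c, ← integral_neg,
    ← integral_const_mul, ← integral_indicator hTm]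
  refine integral_mono i3.neg (IntegrableOn.integrable_indicator (i4.const_mul B) hTm) fun x => ?_
  simp only
  by_cases hx : x ∈ tsupport χ
  · rw [Set.indicator_of_mem hx]
    have h2 : h x ^ s ≤ h x := by
      simpa using Real.rpow_le_rpow_of_exponent_le (h1 x) hs1.le
    have h3 : 0 ≤ h x ^ s := (Real.rpow_pos_of_pos (hpos x) _).le
    have h4 := (abs_le.mp (hB x)).1
    have h5 : 0 ≤ B := (abs_nonneg _).trans (hB x)
    nlinarith [mul_le_mul_of_nonneg_left h2 h5]
  · rw [Set.indicator_of_notMem hx,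
      laplacian_eq_zero_of_notMem_tsupport fun h => hx (hχ2s h)]
    simp

/-- By the Gagliardo-Nirenberg-Sobolev inequality, the energy estimate for `h ^ (s / 2)` bounds
the integral of `h ^ (s n / (n - 2))` on the set where the cut-off `χ` equals one. -/
theorem exists_eLpNorm_le_of_superharmonic {χ : E → ℝ} (hχ : ContDiff ℝ ∞ χ)
    (hχc : HasCompactSupport χ) (hn : 2 < Module.finrank ℝ E) {p : ℝ} (hp0 : 0 < p)
    (hp : p < Module.finrank ℝ E / ((Module.finrank ℝ E : ℝ) - 2)) (D : ℝ) :
    ∃ C : ENNReal, C ≠ ⊤ ∧ ∀ h : E → ℝ, ContDiff ℝ ∞ h → (∀ x, 1 ≤ h x) →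
      (∀ x ∈ tsupport χ, Δ h x ≤ 0) → ∫ x in tsupport χ, h x ≤ D →
      eLpNorm h (ENNReal.ofReal p) (volume.restrict {x | χ x = 1}) ≤ C := by
  set n : ℝ := (Module.finrank ℝ E : ℝ) with hnR
  have hn2 : 2 < n := by rw [hnR]; exact_mod_cast hn
  set s : ℝ := p * (n - 2) / n with hs
  have hs0 : 0 < s := by
    have : 0 < n - 2 := by linarith
    positivity
  have hs1 : s < 1 := by
    rw [hs, div_lt_one (by linarith)]
    rwa [lt_div_iff₀ (by linarith)] at hp
  have hχ1 : ContDiff ℝ 2 χ := hχ.of_le (by norm_cast)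
  have hχ2c : HasCompactSupport fun y => χ y ^ 2 := by
    refine HasCompactSupport.intro' hχc (isClosed_tsupport χ) fun x hx => ?_
    simp [image_eq_zero_of_notMem_tsupport hx]
  obtain ⟨B, hB⟩ := exists_bound_laplacian (hχ1.pow 2) hχ2c
  obtain ⟨G, hG⟩ := hχc.exists_bound_of_continuousOn
    (continuous_gradDot (hχ1.of_le (by norm_num)) (hχ1.of_le (by norm_num))).continuousOn
  set q : NNReal := ⟨2 * n / (n - 2), div_nonneg (by linarith) (by linarith)⟩ with hq
  set A : ENNReal := ((SNormLESNormFDerivOfEqConst ℝ (volume : Measure E) 2 : NNReal) : ENNReal)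
  refine ⟨(A * ENNReal.ofReal ((2 * (s / (4 * (1 - s)) * (|B| * |D|)) + 2 * (|G| * |D|)) ^
    ((2 : ENNReal).toReal⁻¹))) ^ (2 / s), ?_, fun h hh h1 hΔ hD => ?_⟩
  · exact ENNReal.rpow_ne_top_of_nonneg (by positivity)
      (ENNReal.mul_ne_top ENNReal.coe_ne_top ENNReal.ofReal_ne_top)
  have hpos : ∀ x, 0 < h x := fun x => lt_of_lt_of_le one_pos (h1 x)
  have hw : ContDiff ℝ 2 fun y => h y ^ (s / 2) :=
    (hh.of_le (by norm_cast)).rpow_const_of_ne fun x => (hpos x).ne'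
  have hw' : Differentiable ℝ fun y => h y ^ (s / 2) := hw.differentiable (by norm_num)
  set W : E → ℝ := fun y => χ y * h y ^ (s / 2) with hWdef
  have hW : ContDiff ℝ 1 W := (hχ1.mul hw).of_le (by norm_num)
  have hWc : HasCompactSupport W := hχc.mul_right
  have hTm : MeasurableSet (tsupport χ) := (isClosed_tsupport χ).measurableSet
  have i4 : IntegrableOn h (tsupport χ) := hh.continuous.continuousOn.integrableOn_compact hχc
  have hD0 : ∫ x in tsupport χ, h x ≤ |D| := hD.trans (le_abs_self D)
  have hI0 : 0 ≤ ∫ x in tsupport χ, h x := integral_nonneg fun x => (hpos x).le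
  have henergy : ∫ x, ‖fderiv ℝ W x‖ ^ 2 ≤
      2 * (s / (4 * (1 - s)) * (|B| * |D|)) + 2 * (|G| * |D|) := by
    have hgc : Continuous (gradDot (fun y => h y ^ (s / 2)) fun y => h y ^ (s / 2)) :=
      continuous_gradDot (hw.of_le (by norm_num)) (hw.of_le (by norm_num))
    have i1 : Integrable fun x =>
        χ x ^ 2 * gradDot (fun y => h y ^ (s / 2)) (fun y => h y ^ (s / 2)) x :=
      ((hχ1.pow 2).continuous.mul hgc).integrable_of_hasCompactSupport hχ2c.mul_right
    have i2 : Integrable ((tsupport χ).indicator fun x => |G| * h x) :=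
      IntegrableOn.integrable_indicator (i4.const_mul |G|) hTm
    have i3 : Integrable fun x => ‖fderiv ℝ W x‖ ^ 2 :=
      ((hW.continuous_fderiv (by norm_num)).norm.pow 2).integrable_of_hasCompactSupport
        (HasCompactSupport.intro' hWc (isClosed_tsupport W) fun x hx => by
          simp [image_eq_zero_of_notMem_tsupport fun h => hx (tsupport_fderiv_subset ℝ h)])
    have hcac := integral_sq_mul_gradDot_rpow_le hh h1 hχ hχc hΔ hs0 hs1
      (B := |B|) fun x => (hB x).trans (le_abs_self B)
    have hmono : ∫ x, ‖fderiv ℝ W x‖ ^ 2 ≤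
        ∫ x, (2 * (χ x ^ 2 * gradDot (fun y => h y ^ (s / 2)) (fun y => h y ^ (s / 2)) x) +
          2 * (tsupport χ).indicator (fun x => |G| * h x) x) := by
      refine integral_mono i3 ((i1.const_mul 2).add (i2.const_mul 2)) fun x => ?_
      simp only
      rw [sq_norm_fderiv_eq_gradDot]
      refine (gradDot_mul_self_le (hχ1.differentiable (by norm_num) x) (hw' x)).trans ?_
      gcongr
      by_cases hx : x ∈ tsupport χ
      · rw [Set.indicator_of_mem hx, mul_comm]
        have h2 : (h x ^ (s / 2)) ^ 2 ≤ h x := by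
          rw [← Real.rpow_natCast, ← Real.rpow_mul (hpos x).le]
          simpa using Real.rpow_le_rpow_of_exponent_le (h1 x)
            (show s / 2 * ((2 : ℕ) : ℝ) ≤ 1 by push_cast; linarith)
        have h3 := ((le_abs_self _).trans (hG x hx)).trans (le_abs_self G)
        exact mul_le_mul h3 h2 (sq_nonneg _) (abs_nonneg _)
      · rw [Set.indicator_of_notMem hx]
        have : fderiv ℝ χ x = 0 := image_eq_zero_of_notMem_tsupport fun h =>
          hx (tsupport_fderiv_subset ℝ h)
        simp [gradDot, this]
    rw [integral_add (i1.const_mul 2) (i2.const_mul 2), integral_const_mul, integral_const_mul,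
      integral_indicator hTm, integral_const_mul] at hmono
    have hs' : 0 ≤ s / (4 * (1 - s)) := div_nonneg hs0.le (by linarith)
    have c1 : s / (4 * (1 - s)) * (|B| * ∫ x in tsupport χ, h x) ≤
        s / (4 * (1 - s)) * (|B| * |D|) := by gcongr
    have c2 : |G| * ∫ x in tsupport χ, h x ≤ |G| * |D| := by gcongr
    linarith
  have hgns : eLpNorm W q volume ≤ A * eLpNorm (fderiv ℝ W) 2 volume := by
    have := eLpNorm_le_eLpNorm_fderiv_of_eq (volume : Measure E) hW hWc (p := 2) (p' := q)
      one_le_two (by omega) ?_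
    · exact_mod_cast this
    · change (2 * n / (n - 2))⁻¹ = ((2 : NNReal) : ℝ)⁻¹ - n⁻¹
      have : n - 2 ≠ 0 := by linarith
      have : n ≠ 0 := by linarith
      push_cast
      field_simp
  have hnorm2 : eLpNorm (fderiv ℝ W) 2 volume ≤ ENNReal.ofReal
      ((2 * (s / (4 * (1 - s)) * (|B| * |D|)) + 2 * (|G| * |D|)) ^ ((2 : ENNReal).toReal⁻¹)) := by
    have hm : MemLp (fderiv ℝ W) 2 (volume : Measure E) :=
      (hW.continuous_fderiv (by norm_num)).memLp_of_hasCompactSupport (hWc.fderiv ℝ)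
    rw [hm.eLpNorm_eq_integral_rpow_norm (by norm_num) (by norm_num)]
    refine ENNReal.ofReal_le_ofReal (Real.rpow_le_rpow ?_ ?_ (by simp))
    · exact integral_nonneg fun x => by positivity
    · simpa using henergy
  have hpow : h = fun x => ‖h x ^ (s / 2)‖ ^ (2 / s) := by
    funext x
    rw [Real.norm_eq_abs, abs_of_pos (Real.rpow_pos_of_pos (hpos x) _),
      ← Real.rpow_mul (hpos x).le, show s / 2 * (2 / s) = 1 by field_simp, Real.rpow_one]
  have hexp : ENNReal.ofReal p * ENNReal.ofReal (2 / s) = q := by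
    rw [← ENNReal.ofReal_mul hp0.le, ← ENNReal.ofReal_coe_nnreal]
    congr 1
    change p * (2 / s) = 2 * n / (n - 2)
    have : n - 2 ≠ 0 := by linarith
    have : n ≠ 0 := by linarith
    rw [hs]
    field_simp
  conv_lhs => rw [hpow]
  rw [eLpNorm_norm_rpow _ (by positivity), hexp]
  refine ENNReal.rpow_le_rpow ?_ (by positivity)
  calc eLpNorm (fun x => h x ^ (s / 2)) q (volume.restrict {x | χ x = 1})
      = eLpNorm W q (volume.restrict {x | χ x = 1}) := by
        refine eLpNorm_congr_ae ?_
        filter_upwards [ae_restrict_mem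
          (isClosed_eq hχ.continuous continuous_const).measurableSet] with x hx
        have hx1 : χ x = 1 := hx
        simp [hWdef, hx1]
    _ ≤ eLpNorm W q volume := eLpNorm_mono_measure _ Measure.restrict_le_self
    _ ≤ _ := hgns.trans (by gcongr)

/-- Nonnegative superharmonic functions are locally in `L^p` for `p < n / (n - 2)`. -/
theorem WeaklySuperharmonicOn.memLp_of_lt {u : E → ℝ} {Ω K : Set E}
    (hu : WeaklySuperharmonicOn u Ω) (hΩ : IsOpen Ω) (hloc : LocallyIntegrableOn u Ω)
    (hpos : ∀ᵐ x ∂volume.restrict Ω, 0 ≤ u x) (hK : IsCompact K) (hKΩ : K ⊆ Ω)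
    (hn : 2 < Module.finrank ℝ E) {p : ℝ} (hp0 : 0 < p)
    (hp : p < Module.finrank ℝ E / ((Module.finrank ℝ E : ℝ) - 2)) :
    MemLp u (ENNReal.ofReal p) (volume.restrict K) := by
  obtain ⟨χ, hχ, hχc, hχs, hχ1, -⟩ := exists_smooth_cutoff hK hΩ hKΩ
  obtain ⟨f, C, hf, hf0, hfΔ, hfi, hfC, hlim⟩ := hu.exists_smooth_approx hΩ hloc hpos hχc hχs
  have hKχ : K ⊆ {x | χ x = 1} := fun x hx => hχ1.self_of_nhdsSet x hx
  have hKT : K ⊆ tsupport χ := fun x hx => subset_tsupport χ (by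
    have : χ x = 1 := hKχ hx
    simp [this])
  obtain ⟨M, hM, hbound⟩ := exists_eLpNorm_le_of_superharmonic hχ hχc hn hp0 hp
    (C + volume.real (tsupport χ))
  refine memLp_of_tendsto_of_eLpNorm_le
    (fun j => (hf j).continuous.aestronglyMeasurable)
    (ae_mono (Measure.restrict_mono hKT le_rfl) hlim) hM fun j => ?_
  have hT : IntegrableOn (f j) (tsupport χ) := (hfi j).integrableOn
  -- The shift by one keeps the powers smooth and makes `h ^ s ≤ h` for `s < 1`.
  refine le_trans ?_ (hbound (fun x => f j x + 1) ((hf j).add contDiff_const)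
    (fun x => by linarith [hf0 j x]) (fun x hx => ?_) ?_)
  · refine (eLpNorm_mono_real fun x => ?_).trans
      (eLpNorm_mono_measure _ (Measure.restrict_mono hKχ le_rfl))
    rw [Real.norm_eq_abs, abs_of_nonneg (hf0 j x)]
    linarith
  · have := ContDiffAt.laplacian_add (x := x) (f₁ := f j) (f₂ := fun _ => (1 : ℝ))
      ((hf j).of_le (by norm_cast)).contDiffAt contDiffAt_const
    rw [show (fun x => f j x + 1) = f j + fun _ => (1 : ℝ) from rfl, this]
    simpa using hfΔ j x hx
  · rw [integral_add hT (integrableOn_const hχc.measure_lt_top.ne)]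
    simp only [integral_const, smul_eq_mul, mul_one, measureReal_restrict_apply MeasurableSet.univ,
      Set.univ_inter]
    gcongr
    exact (setIntegral_le_integral (hfi j) (Eventually.of_forall (hf0 j))).trans (hfC j)

end Integrability

/-! ### Distributions of order zero -/

section OrderZero

theorem tsupport_const_mul_add_const_mul_subset {X : Type*} [TopologicalSpace X]
    {f g : X → ℝ} (a b : ℝ) :
    tsupport (fun y => a * f y + b * g y) ⊆ tsupport f ∪ tsupport g := by
  refine (closure_minimal (fun x hx => ?_) ((isClosed_tsupport f).union (isClosed_tsupport g)))
  by_contra h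
  simp only [Set.mem_union, not_or] at h
  exact hx (by simp [image_eq_zero_of_notMem_tsupport h.1, image_eq_zero_of_notMem_tsupport h.2])

variable {E : Type*} [NormedAddCommGroup E] [InnerProductSpace ℝ E] [FiniteDimensional ℝ E]

theorem laplacian_const_mul_add_const_mul {f g : E → ℝ} (hf : ContDiff ℝ 2 f)
    (hg : ContDiff ℝ 2 g) (a b : ℝ) (x : E) :
    Δ (fun y => a * f y + b * g y) x = a * Δ f x + b * Δ g x := by
  have h := ContDiffAt.laplacian_add (x := x) (f₁ := a • f) (f₂ := b • g)
    (contDiff_const.smul hf).contDiffAt (contDiff_const.smul hg).contDiffAt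
  rw [InnerProductSpace.laplacian_smul a hf.contDiffAt,
    InnerProductSpace.laplacian_smul b hg.contDiffAt] at h
  exact h

variable [MeasurableSpace E] [BorelSpace E]

theorem MeasureTheory.LocallyIntegrableOn.integrable_mul_laplacian {u φ : E → ℝ} {Ω : Set E}
    (hu : LocallyIntegrableOn u Ω) (hφ : ContDiff ℝ ∞ φ) (hc : HasCompactSupport φ)
    (hs : tsupport φ ⊆ Ω) : Integrable fun x => u x * Δ φ x :=
  (hu.integrableOn_compact_subset hs hc).integrable_mul_of_eq_zero hc
    ((hφ.of_le (by norm_cast) : ContDiff ℝ 2 φ).continuous_laplacian)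
    fun _ => laplacian_eq_zero_of_notMem_tsupport

theorem integral_mul_laplacian_const_mul_add {u φ ψ : E → ℝ} {Ω : Set E}
    (hu : LocallyIntegrableOn u Ω) (hφ : ContDiff ℝ ∞ φ) (hφc : HasCompactSupport φ)
    (hφs : tsupport φ ⊆ Ω) (hψ : ContDiff ℝ ∞ ψ) (hψc : HasCompactSupport ψ)
    (hψs : tsupport ψ ⊆ Ω) (a b : ℝ) :
    ∫ x, u x * Δ (fun y => a * φ y + b * ψ y) x =
      a * (∫ x, u x * Δ φ x) + b * ∫ x, u x * Δ ψ x := by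
  rw [← integral_const_mul, ← integral_const_mul,
    ← integral_add ((hu.integrable_mul_laplacian hφ hφc hφs).const_mul a)
      ((hu.integrable_mul_laplacian hψ hψc hψs).const_mul b)]
  refine integral_congr_ae (Eventually.of_forall fun x => ?_)
  simp only
  rw [laplacian_const_mul_add_const_mul (hφ.of_le (by norm_cast)) (hψ.of_le (by norm_cast))]
  ring

/-- A nonnegative distribution `-Δu` supported in the compact set `Γ` is bounded by a multiple of
the supremum of the test function on `Γ`: near `Γ` the test function is dominated by its supremum
there, and `-Δu` does not see the rest. -/
theorem WeaklySuperharmonicOn.exists_abs_integral_le {u : E → ℝ} {Ω Γ : Set E}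
    (hu : WeaklySuperharmonicOn u Ω) (hΩ : IsOpen Ω) (hloc : LocallyIntegrableOn u Ω)
    (hΓ : IsCompact Γ) (hΓΩ : Γ ⊆ Ω)
    (hharm : ∀ φ : E → ℝ, ContDiff ℝ ∞ φ → HasCompactSupport φ → tsupport φ ⊆ Ω \ Γ →
      ∫ x, u x * Δ φ x = 0) :
    ∃ A : ℝ, 0 ≤ A ∧ ∀ φ : E → ℝ, ContDiff ℝ ∞ φ → HasCompactSupport φ → tsupport φ ⊆ Ω →
      ∀ M : ℝ, (∀ x ∈ Γ, |φ x| ≤ M) → |∫ x, u x * Δ φ x| ≤ A * M := by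
  obtain ⟨χ₀, h₀, h₀c, h₀s, h₀1, h₀01⟩ := exists_smooth_cutoff hΓ hΩ hΓΩ
  set A := -∫ x, u x * Δ χ₀ x
  -- The pairing depends only on the germ of the test function along `Γ`.
  have hgerm : ∀ φ ψ : E → ℝ, ContDiff ℝ ∞ φ → HasCompactSupport φ → tsupport φ ⊆ Ω →
      ContDiff ℝ ∞ ψ → HasCompactSupport ψ → tsupport ψ ⊆ Ω → (∀ᶠ x in 𝓝ˢ Γ, φ x = ψ x) →
      ∫ x, u x * Δ φ x = ∫ x, u x * Δ ψ x := by
    intro φ ψ hφ hφc hφs hψ hψc hψs heq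
    have hsub := tsupport_const_mul_add_const_mul_subset (f := φ) (g := ψ) 1 (-1)
    have := hharm (fun y => 1 * φ y + -1 * ψ y)
      ((contDiff_const.mul hφ).add (contDiff_const.mul hψ))
      ((hφc.isCompact.union hψc.isCompact).of_isClosed_subset (isClosed_tsupport _) hsub)
      fun x hx => ⟨hsub.trans (Set.union_subset hφs hψs) hx, fun hxΓ => ?_⟩
    · rw [integral_mul_laplacian_const_mul_add hloc hφ hφc hφs hψ hψc hψs] at this
      linarith
    · refine notMem_tsupport_iff_eventuallyEq.mpr ?_ hx
      filter_upwards [(eventually_nhdsSet_iff_forall.mp heq) x hxΓ] with y hy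
      simp [hy]
  have hupper : ∀ φ : E → ℝ, ContDiff ℝ ∞ φ → HasCompactSupport φ → tsupport φ ⊆ Ω →
      ∀ M : ℝ, (∀ x ∈ Γ, φ x ≤ M) → -∫ x, u x * Δ φ x ≤ A * M := by
    intro φ hφ hφc hφs M hM
    have hδ : ∀ δ : ℝ, 0 < δ → -∫ x, u x * Δ φ x ≤ A * (M + δ) := by
      intro δ hδ
      obtain ⟨χ, hχ, hχc, hχs, hχ1, hχ01⟩ := exists_smooth_cutoff hΓ
        (hΩ.inter (isOpen_lt hφ.continuous (continuous_const (y := M + δ))))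
        fun x hx => ⟨hΓΩ hx, lt_of_le_of_lt (hM x hx) (by linarith)⟩
      have hχΩ : tsupport χ ⊆ Ω := fun x hx => (hχs hx).1
      have hφχ : ContDiff ℝ ∞ fun y => φ y * χ y := hφ.mul hχ
      have hφχc : HasCompactSupport fun y => φ y * χ y := hφc.mul_right
      have hφχs : tsupport (fun y => φ y * χ y) ⊆ Ω := tsupport_mul_subset_left.trans hφs
      have e1 : ∫ x, u x * Δ φ x = ∫ x, u x * Δ (fun y => φ y * χ y) x :=
        hgerm _ _ hφ hφc hφs hφχ hφχc hφχs (hχ1.mono fun x hx => by simp [hx])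
      have e2 : ∫ x, u x * Δ χ x = ∫ x, u x * Δ χ₀ x :=
        hgerm _ _ hχ hχc hχΩ h₀ h₀c h₀s
          ((hχ1.and h₀1).mono fun x hx => by rw [hx.1, hx.2])
      have hsub := tsupport_const_mul_add_const_mul_subset (f := χ) (g := fun y => φ y * χ y)
        (M + δ) (-1)
      have e3 := hu (fun y => (M + δ) * χ y + -1 * (φ y * χ y))
        ((contDiff_const.mul hχ).add (contDiff_const.mul hφχ))
        ((hχc.isCompact.union hφχc.isCompact).of_isClosed_subset (isClosed_tsupport _) hsub)
        (hsub.trans (Set.union_subset hχΩ hφχs)) fun x => by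
          by_cases hx : x ∈ tsupport χ
          · have h1 : φ x < M + δ := (hχs hx).2
            nlinarith [(hχ01 x).1]
          · simp [image_eq_zero_of_notMem_tsupport hx]
      rw [integral_mul_laplacian_const_mul_add hloc hχ hχc hχΩ hφχ hφχc hφχs, e2, ← e1] at e3
      simp only [A]
      linarith
    have hcont : Tendsto (fun δ : ℝ => A * (M + δ)) (𝓝[>] 0) (𝓝 (A * (M + 0))) :=
      ((continuous_const.mul (continuous_const.add continuous_id)).tendsto 0).mono_left
        nhdsWithin_le_nhds
    rw [add_zero] at hcont
    exact ge_of_tendsto hcont (by filter_upwards [self_mem_nhdsWithin] with δ h using hδ δ h)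
  refine ⟨A, ?_, fun φ hφ hφc hφs M hM => ?_⟩
  · have := hu χ₀ h₀ h₀c h₀s fun x => (h₀01 x).1
    simp only [A]
    linarith
  · have b1 := hupper φ hφ hφc hφs M fun x hx => (abs_le.mp (hM x hx)).2
    have b2 := hupper (fun y => -φ y) hφ.neg hφc.neg
      (by rwa [show (fun y => -φ y) = -φ from rfl, tsupport_neg]) M
      fun x hx => by linarith [(abs_le.mp (hM x hx)).1]
    have e : ∫ x, u x * Δ (fun y => -φ y) x = -∫ x, u x * Δ φ x := by
      rw [← integral_neg]
      refine integral_congr_ae (Eventually.of_forall fun x => ?_)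
      simp only
      rw [show (fun y => -φ y) = -φ from rfl, InnerProductSpace.laplacian_neg]
      simp
    rw [e] at b2
    exact abs_le.mpr ⟨by linarith, by linarith⟩

end OrderZero

/-! ### Extension of functionals -/

section HahnBanach

/-- A linear functional dominated by the norm of a linear map `J` is a bounded functional of `J`. -/
theorem exists_continuousLinearMap_comp_eq {X V : Type*} [AddCommGroup X] [Module ℝ X]
    [NormedAddCommGroup V] [NormedSpace ℝ V] (J : X →ₗ[ℝ] V) (L : X →ₗ[ℝ] ℝ) (A : ℝ)
    (h : ∀ x, |L x| ≤ A * ‖J x‖) : ∃ F : V →L[ℝ] ℝ, ∀ x, F (J x) = L x := by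
  have hker : LinearMap.ker J ≤ LinearMap.ker L := by
    intro x hx
    have := h x
    rw [LinearMap.mem_ker.mp hx, norm_zero, mul_zero] at this
    exact LinearMap.mem_ker.mpr (abs_nonpos_iff.mp this)
  let f : LinearMap.range J →ₗ[ℝ] ℝ :=
    ((LinearMap.ker J).liftQ L hker).comp J.quotKerEquivRange.symm.toLinearMap
  have hf : ∀ x, f ⟨J x, LinearMap.mem_range_self J x⟩ = L x := by
    intro x
    have : J.quotKerEquivRange.symm ⟨J x, LinearMap.mem_range_self J x⟩ =
        (LinearMap.ker J).mkQ x := J.quotKerEquivRange_symm_apply_image x _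
    simp [f, this]
  obtain ⟨F, hF, -⟩ := exists_extension_norm_eq (LinearMap.range J)
    (f.mkContinuous A (by
      rintro ⟨_, x, rfl⟩
      rw [hf]
      exact h x))
  exact ⟨F, fun x => (hF ⟨J x, LinearMap.mem_range_self J x⟩).trans (hf x)⟩

end HahnBanach

/-! ### Functions and distributions on the circle -/

section CircleFunctions

/-- Lebesgue measure on the parameter interval `(0, 2π]` of `Γ`. -/
noncomputable abbrev angleMeasure : Measure ℝ := volume.restrict (Set.Ioc 0 (2 * Real.pi))

theorem exists_integral_abs_le_norm_toLp {α : Type*} [MeasurableSpace α] (μ : Measure α)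
    [IsFiniteMeasure μ] : ∃ c : ℝ, 0 ≤ c ∧ ∀ (f : α → ℝ) (hf : MemLp f 2 μ),
      ∫ x, |f x| ∂μ ≤ c * ‖hf.toLp f‖ := by
  have hfin : μ Set.univ ^ (1 / (1 : ENNReal).toReal - 1 / (2 : ENNReal).toReal) ≠ ⊤ :=
    ENNReal.rpow_ne_top_of_nonneg (by norm_num) (measure_ne_top μ _)
  refine ⟨(μ Set.univ ^ (1 / (1 : ENNReal).toReal - 1 / (2 : ENNReal).toReal)).toReal,
    ENNReal.toReal_nonneg, fun f hf => ?_⟩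
  have h := eLpNorm_le_eLpNorm_mul_rpow_measure_univ (p := 1) (q := 2) (by norm_num)
    hf.aestronglyMeasurable
  rw [Lp.norm_toLp, mul_comm, ← ENNReal.toReal_mul]
  refine le_of_eq_of_le ?_ (ENNReal.toReal_mono (ENNReal.mul_ne_top hf.2.ne hfin) h)
  rw [eLpNorm_one_eq_lintegral_enorm]
  exact integral_norm_eq_lintegral_enorm hf.aestronglyMeasurable

/-- One-dimensional Sobolev inequality on a period. -/
theorem abs_le_integral_add_integral_deriv {g : ℝ → ℝ} (hg : ContDiff ℝ 1 g) {θ : ℝ}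
    (hθ : θ ∈ Set.Ioc 0 (2 * Real.pi)) :
    2 * Real.pi * |g θ| ≤ ∫ t, |g t| ∂angleMeasure +
      2 * Real.pi * ∫ t, |deriv g t| ∂angleMeasure := by
  have hpi := Real.pi_pos
  have hg' : Continuous (deriv g) := hg.continuous_deriv (by norm_num)
  have hint : ∀ f : ℝ → ℝ, Continuous f → Integrable f angleMeasure := fun f hf =>
    (hf.integrableOn_Icc).mono_set Set.Ioc_subset_Icc_self
  have hpt : ∀ t ∈ Set.Ioc 0 (2 * Real.pi), |g θ| ≤ |g t| + ∫ s, |deriv g s| ∂angleMeasure := by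
    intro t ht
    have h1 : ∫ y in t..θ, deriv g y = g θ - g t := intervalIntegral.integral_deriv_eq_sub
      (fun x _ => hg.differentiable (by norm_num) x) (hg'.intervalIntegrable _ _)
    have h2 : |g θ - g t| ≤ ∫ s, |deriv g s| ∂angleMeasure := by
      rw [← h1, ← Real.norm_eq_abs]
      refine intervalIntegral.norm_integral_le_integral_norm_uIoc.trans ?_
      refine setIntegral_mono_set (hint _ hg'.abs) (Eventually.of_forall fun x => abs_nonneg _)
        (LE.le.eventuallyLE fun x hx => ?_)
      rw [Set.uIoc, Set.mem_Ioc] at hx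
      exact ⟨(le_min ht.1.le hθ.1.le).trans_lt hx.1, hx.2.trans (max_le ht.2 hθ.2)⟩
    have h3 := abs_add_le (g t) (g θ - g t)
    rw [add_sub_cancel] at h3
    linarith
  have hmono : ∫ _t, |g θ| ∂angleMeasure ≤
      ∫ t, (|g t| + ∫ s, |deriv g s| ∂angleMeasure) ∂angleMeasure := by
    refine integral_mono_ae (integrable_const _)
      ((hint _ hg.continuous.abs).add (integrable_const _)) ?_
    filter_upwards [ae_restrict_mem measurableSet_Ioc] with t ht using hpt t ht
  rw [integral_add (hint _ hg.continuous.abs) (integrable_const _)] at hmono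
  simpa [angleMeasure, measureReal_def, hpi.le] using hmono

variable {n : ℕ}

theorem contDiff_smoothΓ {hn : 2 ≤ n} (g : SmoothΓ hn) :
    ContDiff ℝ ∞ fun θ => g.1 (circleParam hn θ) :=
  Set.mem_ofPred_eq.mp g.2

theorem continuous_tangentialDeriv {hn : 2 ≤ n} (k : ℕ) (g : SmoothΓ hn) :
    Continuous (tangentialDeriv k g) :=
  ContDiff.continuous_iteratedDeriv k (contDiff_smoothΓ g) (by exact_mod_cast le_top)

theorem memLp_tangentialDeriv {hn : 2 ≤ n} (k : ℕ) (g : SmoothΓ hn) (p : ENNReal) :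
    MemLp (tangentialDeriv k g) p angleMeasure := by
  obtain ⟨C, hC⟩ := (isCompact_Icc (a := (0 : ℝ)) (b := 2 * Real.pi)).exists_bound_of_continuousOn
    (continuous_tangentialDeriv k g).continuousOn
  refine MemLp.of_bound (continuous_tangentialDeriv k g).aestronglyMeasurable C ?_
  filter_upwards [ae_restrict_mem measurableSet_Ioc] with t ht
    using hC t (Set.Ioc_subset_Icc_self ht)

/-- The `k`-th tangential derivative of smooth functions on `Γ`, as an element of `L²`. -/
noncomputable def tangentialDerivL2 (hn : 2 ≤ n) (k : ℕ) :
    SmoothΓ hn →ₗ[ℝ] Lp ℝ 2 angleMeasure where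
  toFun g := (memLp_tangentialDeriv k g 2).toLp _
  map_add' g h := by
    rw [← MemLp.toLp_add]
    refine MemLp.toLp_congr _ _ (Eventually.of_forall fun θ => ?_)
    exact iteratedDeriv_fun_add ((contDiff_smoothΓ g).contDiffAt.of_le (by exact_mod_cast le_top))
      ((contDiff_smoothΓ h).contDiffAt.of_le (by exact_mod_cast le_top))
  map_smul' c g := by
    rw [RingHom.id_apply, ← MemLp.toLp_const_smul]
    refine MemLp.toLp_congr _ _ (Eventually.of_forall fun θ => ?_)
    exact iteratedDeriv_fun_const_smul_field c _

/-- The inverse of the parametrization of `Γ` by `(0, 2π]`. -/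
noncomputable def circleAngle (hn : 2 ≤ n) (x : circleΓ hn) : ℝ :=
  if 0 < Complex.arg ⟨x.1 ⟨0, by omega⟩, x.1 ⟨1, by omega⟩⟩ then
    Complex.arg ⟨x.1 ⟨0, by omega⟩, x.1 ⟨1, by omega⟩⟩
  else Complex.arg ⟨x.1 ⟨0, by omega⟩, x.1 ⟨1, by omega⟩⟩ + 2 * Real.pi

theorem measurable_circleAngle (hn : 2 ≤ n) : Measurable (circleAngle hn) := by
  have h : Measurable fun x : circleΓ hn =>
      Complex.arg ⟨x.1 ⟨0, by omega⟩, x.1 ⟨1, by omega⟩⟩ := by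
    refine Complex.measurable_arg.comp ?_
    have : Continuous fun x : circleΓ hn =>
        Complex.equivRealProdCLM.symm (x.1 ⟨0, by omega⟩, x.1 ⟨1, by omega⟩) := by fun_prop
    exact this.measurable
  exact Measurable.ite (measurableSet_lt measurable_const h) h (h.add_const _)

theorem circleAngle_circleParam (hn : 2 ≤ n) {θ : ℝ} (hθ : θ ∈ Set.Ioc 0 (2 * Real.pi)) :
    circleAngle hn (circleParam hn θ) = θ := by
  have hpi := Real.pi_pos
  have hz : (⟨(circleParam hn θ).1 ⟨0, by omega⟩, (circleParam hn θ).1 ⟨1, by omega⟩⟩ : ℂ) =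
      Complex.cos θ + Complex.sin θ * Complex.I := by
    rw [← Complex.ofReal_cos, ← Complex.ofReal_sin]
    apply Complex.ext <;> simp [circleParam, circleVec, -Complex.ofReal_cos, -Complex.ofReal_sin]
  unfold circleAngle
  rw [hz]
  by_cases h : θ ≤ Real.pi
  · rw [Complex.arg_cos_add_sin_mul_I ⟨by linarith [hθ.1], h⟩, if_pos hθ.1]
  · have e : Complex.cos θ + Complex.sin θ * Complex.I =
        Complex.cos ((θ - 2 * Real.pi : ℝ) : ℂ) +
          Complex.sin ((θ - 2 * Real.pi : ℝ) : ℂ) * Complex.I := by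
      rw [← Complex.ofReal_cos, ← Complex.ofReal_sin, ← Complex.ofReal_cos, ← Complex.ofReal_sin,
        Real.cos_sub_two_pi, Real.sin_sub_two_pi]
    rw [e, Complex.arg_cos_add_sin_mul_I ⟨by linarith, by linarith [hθ.2]⟩,
      if_neg (by linarith [hθ.2])]
    ring

theorem exists_circleParam_eq (hn : 2 ≤ n) (x : circleΓ hn) :
    ∃ θ ∈ Set.Ioc 0 (2 * Real.pi), circleParam hn θ = x := by
  obtain ⟨t, ht, h⟩ := exists_norm_sub_circleVec_le hn x.1
  rw [(circleDefining_eq_zero_iff hn x.1).mpr x.2, norm_zero] at h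
  have hx : x.1 = circleVec n t := sub_eq_zero.mp (norm_le_zero_iff.mp h)
  have hpi := Real.pi_pos
  by_cases h0 : 0 < t
  · exact ⟨t, ⟨h0, by linarith [ht.2]⟩, Subtype.ext hx.symm⟩
  · refine ⟨t + 2 * Real.pi, ⟨by linarith [ht.1], by linarith⟩, Subtype.ext ?_⟩
    rw [hx]
    simp [circleParam, circleVec]

theorem isCompact_circleΓ (hn : 2 ≤ n) : IsCompact (circleΓ hn) := by
  have h : circleΓ hn = circleVec n '' Set.Icc 0 (2 * Real.pi) := by
    ext x
    constructor
    · intro hx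
      obtain ⟨θ, hθ, h⟩ := exists_circleParam_eq hn ⟨x, hx⟩
      exact ⟨θ, Set.Ioc_subset_Icc_self hθ, congrArg Subtype.val h⟩
    · rintro ⟨θ, -, rfl⟩
      exact circleVec_mem hn θ
  rw [h]
  exact isCompact_Icc.image (contDiff_circleVec n).continuous

theorem circleΓ_subset_closedBall (hn : 2 ≤ n) :
    circleΓ hn ⊆ Metric.closedBall (0 : EuclideanSpace ℝ (Fin n)) 1 := by
  intro x hx
  rw [mem_closedBall_zero_iff, EuclideanSpace.norm_eq, Real.sqrt_le_one]
  have h2 : ∀ i : Fin n, i ∉ ({⟨0, by omega⟩, ⟨1, by omega⟩} : Finset (Fin n)) → ‖x i‖ ^ 2 = 0 := by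
    intro i hi
    simp only [Finset.mem_insert, Finset.mem_singleton, not_or, Fin.ext_iff] at hi
    rw [hx.2 i (by omega)]
    simp
  rw [← Finset.sum_subset (Finset.subset_univ _) fun i _ hi => h2 i hi,
    Finset.sum_pair (by simp [Fin.ext_iff])]
  simpa using hx.1.le

theorem exists_abs_le_norm_tangentialDerivL2 (hn : 2 ≤ n) : ∃ c : ℝ, 0 ≤ c ∧
    ∀ (g : SmoothΓ hn) (x : circleΓ hn),
      |g.1 x| ≤ c * ‖(tangentialDerivL2 hn 0 g, tangentialDerivL2 hn 1 g)‖ := by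
  obtain ⟨c, hc, h⟩ := exists_integral_abs_le_norm_toLp angleMeasure
  have hpi := Real.pi_pos
  refine ⟨c / (2 * Real.pi) + c, by positivity, fun g x => ?_⟩
  obtain ⟨θ, hθ, rfl⟩ := exists_circleParam_eq hn x
  have h1 := abs_le_integral_add_integral_deriv
    (g := fun t => g.1 (circleParam hn t)) ((contDiff_smoothΓ g).of_le (by norm_cast)) hθ
  have e0 : tangentialDeriv 0 g = fun t => g.1 (circleParam hn t) := by
    funext t; simp [tangentialDeriv]
  have e1 : tangentialDeriv 1 g = deriv fun t => g.1 (circleParam hn t) := by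
    funext t; simp [tangentialDeriv, iteratedDeriv_one]
  rw [← e1] at h1
  have b0 := h _ (memLp_tangentialDeriv 0 g 2)
  have b1 := h _ (memLp_tangentialDeriv 1 g 2)
  set N := ‖(tangentialDerivL2 hn 0 g, tangentialDerivL2 hn 1 g)‖
  have n0 : ‖tangentialDerivL2 hn 0 g‖ ≤ N :=
    norm_fst_le (tangentialDerivL2 hn 0 g, tangentialDerivL2 hn 1 g)
  have n1 : ‖tangentialDerivL2 hn 1 g‖ ≤ N :=
    norm_snd_le (tangentialDerivL2 hn 0 g, tangentialDerivL2 hn 1 g)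
  have c0 : ∫ t, |tangentialDeriv 0 g t| ∂angleMeasure ≤ c * N :=
    b0.trans (mul_le_mul_of_nonneg_left n0 hc)
  have c1 : ∫ t, |tangentialDeriv 1 g t| ∂angleMeasure ≤ c * N :=
    b1.trans (mul_le_mul_of_nonneg_left n1 hc)
  simp only [e0] at c0
  have h2 : 2 * Real.pi * |g.1 (circleParam hn θ)| ≤ c * N + 2 * Real.pi * (c * N) := by
    refine h1.trans ?_
    gcongr
  calc |g.1 (circleParam hn θ)| = (2 * Real.pi * |g.1 (circleParam hn θ)|) / (2 * Real.pi) := by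
        field_simp
    _ ≤ (c * N + 2 * Real.pi * (c * N)) / (2 * Real.pi) := by gcongr
    _ = (c / (2 * Real.pi) + c) * N := by field_simp

/-- Functionals bounded in the `H¹` norm are distributions in `W^{-1,2}(Γ)`, by the Riesz
representation theorem in `L² × L²`; for `p ≤ 2` they lie in `W^{-2,p}(Γ)`. -/
theorem exists_distributionΓ_memNegSobolev (hn : 2 ≤ n)
    (F : (Lp ℝ 2 angleMeasure × Lp ℝ 2 angleMeasure) →L[ℝ] ℝ) {p : ℝ} (hp : p ≤ 2) :
    ∃ v : DistributionΓ hn, v.MemNegSobolev 2 p ∧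
      ∀ g, v.toLinearMap g = F (tangentialDerivL2 hn 0 g, tangentialDerivL2 hn 1 g) := by
  let J := (tangentialDerivL2 hn 0).prod (tangentialDerivL2 hn 1)
  have hcont : ∀ (g : SmoothΓ hn) (M : ℝ),
      (∀ k ≤ 1, ∀ θ : ℝ, |tangentialDeriv k g θ| ≤ M) → |(F.toLinearMap.comp J) g| ≤
        (‖F‖ * measureUnivNNReal angleMeasure ^ (2 : ENNReal).toReal⁻¹) * M := by
    intro g M hM
    have hM0 : 0 ≤ M := (abs_nonneg _).trans (hM 0 (by norm_num) 0)
    have hk : ∀ k ≤ 1, ‖tangentialDerivL2 hn k g‖ ≤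
        measureUnivNNReal angleMeasure ^ (2 : ENNReal).toReal⁻¹ * M := by
      intro k hk
      refine Lp.norm_le_of_ae_bound hM0 ?_
      filter_upwards [(memLp_tangentialDeriv k g 2).coeFn_toLp] with θ hθ
      rw [show (tangentialDerivL2 hn k g) = (memLp_tangentialDeriv k g 2).toLp _ from rfl, hθ]
      exact hM k hk θ
    refine (F.le_opNorm (J g)).trans ?_
    rw [mul_assoc]
    exact mul_le_mul_of_nonneg_left
      (max_le (hk 0 (by norm_num)) (hk 1 le_rfl)) (norm_nonneg F)
  refine ⟨⟨F.toLinearMap.comp J, 1, _, hcont⟩, ?_, fun g => rfl⟩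
  set W₀ : Lp ℝ 2 angleMeasure := (InnerProductSpace.toDual ℝ _).symm
    (F.comp (ContinuousLinearMap.inl ℝ _ _))
  set W₁ : Lp ℝ 2 angleMeasure := (InnerProductSpace.toDual ℝ _).symm
    (F.comp (ContinuousLinearMap.inr ℝ _ _))
  have hsplit : ∀ a b, F (a, b) = inner ℝ W₀ a + inner ℝ W₁ b := by
    intro a b
    rw [InnerProductSpace.toDual_symm_apply, InnerProductSpace.toDual_symm_apply]
    simp only [ContinuousLinearMap.comp_apply, ContinuousLinearMap.inl_apply,
      ContinuousLinearMap.inr_apply]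
    rw [← map_add]
    simp
  have hmem : ∀ W : Lp ℝ 2 angleMeasure,
      MemLp (fun x => W (circleAngle hn x)) (ENNReal.ofReal p) (arcLength hn) := by
    intro W
    have hcp : Measurable (circleParam hn) :=
      ((contDiff_circleVec n).continuous.subtype_mk _).measurable
    have hWm : StronglyMeasurable fun x => W (circleAngle hn x) :=
      (Lp.stronglyMeasurable W).comp_measurable (measurable_circleAngle hn)
    refine (memLp_map_measure_iff hWm.aestronglyMeasurable hcp.aemeasurable).mpr ?_
    have h2 : MemLp W (ENNReal.ofReal p) angleMeasure :=
      (Lp.memLp W).mono_exponent (by simpa using ENNReal.ofReal_le_ofReal hp)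
    refine h2.ae_eq ?_
    filter_upwards [ae_restrict_mem measurableSet_Ioc] with θ hθ
    simp [circleAngle_circleParam hn hθ]
  have hpair : ∀ (W : Lp ℝ 2 angleMeasure) (k : ℕ) (g : SmoothΓ hn),
      inner ℝ W (tangentialDerivL2 hn k g) = ∫ θ in (0 : ℝ)..(2 * Real.pi),
        W (circleAngle hn (circleParam hn θ)) * tangentialDeriv k g θ := by
    intro W k g
    rw [intervalIntegral.integral_of_le (by positivity), L2.inner_def]
    refine integral_congr_ae ?_
    filter_upwards [(memLp_tangentialDeriv k g 2).coeFn_toLp,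
      ae_restrict_mem measurableSet_Ioc] with θ h1 h2
    rw [show (tangentialDerivL2 hn k g) = (memLp_tangentialDeriv k g 2).toLp _ from rfl, h1,
      circleAngle_circleParam hn h2]
    simp [mul_comm]
  refine ⟨fun k x => if k = 0 then W₀ (circleAngle hn x) else
    if k = 1 then -W₁ (circleAngle hn x) else 0, ?_, ?_⟩
  · intro k _
    by_cases h0 : k = 0
    · simpa only [h0, if_true] using hmem W₀
    · by_cases h1 : k = 1
      · simp only [h1, one_ne_zero, if_false, if_true]
        exact (hmem W₁).neg
      · simp [h0, h1]
  · intro g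
    change F (tangentialDerivL2 hn 0 g, tangentialDerivL2 hn 1 g) = _
    rw [hsplit, hpair, hpair]
    simp [Finset.sum_range_succ]

end CircleFunctions

/-! ### Nonnegative harmonic functions off the circle -/

theorem theorem1 (n : ℕ) (hn : 4 ≤ n) (u : EuclideanSpace ℝ (Fin n) → ℝ)
    (hu_loc : LocallyIntegrableOn u
      (ballTwoDiffΓ (show 2 ≤ n by omega) : Set (EuclideanSpace ℝ (Fin n))) volume)
    (hu_nonneg : ∀ᵐ x ∂(volume.restrict
      (ballTwoDiffΓ (show 2 ≤ n by omega) : Set (EuclideanSpace ℝ (Fin n)))), 0 ≤ u x)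
    (hu_harm : IsDistribHarmonic u (ballTwoDiffΓ (show 2 ≤ n by omega)))
    (p : ℝ) (hp1 : 1 ≤ p) (hp2 : p < (n : ℝ) / ((n : ℝ) - 2)) :
    MemLpLoc u p (ballTwo n) ∧
    ∃ v : DistributionΓ (show 2 ≤ n by omega),
      v.MemNegSobolev 2 p ∧
      ∀ φ : 𝓓(ballTwo n, ℝ), negLaplacianPairing u φ =
        v.toLinearMap (restrictΓ (show 2 ≤ n by omega) φ) := by
  have hn2 : 2 ≤ n := by omega
  have : Nontrivial (EuclideanSpace ℝ (Fin n)) :=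
    Module.nontrivial_of_finrank_pos (R := ℝ) (by rw [finrank_euclideanSpace_fin]; omega)
  set Γ := circleΓ hn2
  set B := Metric.ball (0 : EuclideanSpace ℝ (Fin n)) 2
  have hB : IsOpen B := Metric.isOpen_ball
  have hΓB : Γ ⊆ B := (circleΓ_subset_closedBall hn2).trans
    (Metric.closedBall_subset_ball (by norm_num))
  have hBΓ : IsOpen (B \ Γ) := hB.sdiff (isClosed_circleΓ hn2)
  have hpair : ∀ (Ω : Opens (EuclideanSpace ℝ (Fin n))) (φ : 𝓓(Ω, ℝ)),
      negLaplacianPairing u φ = -∫ x, u x * Δ (φ : EuclideanSpace ℝ (Fin n) → ℝ) x := by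
    intro Ω φ
    unfold negLaplacianPairing
    rw [setIntegral_eq_integral_of_forall_compl_eq_zero, ← integral_neg]
    · simp
    · intro x hx
      rw [laplacian_eq_zero_of_notMem_tsupport fun h => hx (φ.tsupport_subset h)]
      simp
  have hharm : ∀ φ : EuclideanSpace ℝ (Fin n) → ℝ, ContDiff ℝ ∞ φ → HasCompactSupport φ →
      tsupport φ ⊆ B \ Γ → ∫ x, u x * Δ φ x = 0 := by
    intro φ hφ hc hs
    have h1 := hu_harm ⟨φ, hφ, hc, hs⟩
    rw [hpair, neg_eq_zero] at h1
    exact h1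
  have hae : (B \ Γ : Set (EuclideanSpace ℝ (Fin n))) =ᵐ[volume] B :=
    sdiff_null_ae_eq_self (volume_circleΓ hn2 (by omega))
  have hpos : ∀ᵐ x ∂volume.restrict B, 0 ≤ u x := by
    rw [← Measure.restrict_congr_set hae]
    exact hu_nonneg
  have hum : AEStronglyMeasurable u (volume.restrict B) := by
    rw [← Measure.restrict_congr_set hae]
    exact hu_loc.aestronglyMeasurable
  have hsat : ∀ k : ℝ, 0 < k → WeaklySuperharmonicOn (fun x => saturate k (u x)) B := by
    intro k hk
    have hw : WeaklySuperharmonicOn u (B \ Γ) := fun φ hφ hc hs _ => (hharm φ hφ hc hs).le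
    refine (hw.comp_saturate hBΓ hu_loc hu_nonneg hk).of_cutoffs (M := k)
      (fun K hK _ => (hum.mono_measure (Measure.restrict_mono hK le_rfl)).saturate k) ?_ hB
      fun K _ hKc => exists_cutoffs_circle hn2 hn hKc
    filter_upwards [hpos] with x hx
    rw [abs_of_nonneg (saturate_nonneg hk hx)]
    exact saturate_le_left hk hx
  have hloc : LocallyIntegrableOn u B :=
    locallyIntegrableOn_of_saturate (circleΓ_subset_closedBall hn2) hum hsat hu_loc hpos
  have hsuper : WeaklySuperharmonicOn u B := .of_saturate hsat hB hloc hpos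
  have hn4 : (4 : ℝ) ≤ n := by exact_mod_cast hn
  refine ⟨fun K hK hKc => hsuper.memLp_of_lt hB hloc hpos hKc hK
    (by rw [finrank_euclideanSpace_fin]; omega) (by linarith)
    (by rwa [finrank_euclideanSpace_fin]), ?_⟩
  obtain ⟨A, hA, hbound⟩ := hsuper.exists_abs_integral_le hB hloc (isCompact_circleΓ hn2) hΓB hharm
  obtain ⟨c, hc, hsob⟩ := exists_abs_le_norm_tangentialDerivL2 hn2
  let R : 𝓓(ballTwo n, ℝ) →ₗ[ℝ] SmoothΓ hn2 :=
    { toFun := restrictΓ hn2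
      map_add' := fun φ ψ => rfl
      map_smul' := fun a φ => rfl }
  let J := ((tangentialDerivL2 hn2 0).prod (tangentialDerivL2 hn2 1)).comp R
  have hlin : ∀ (φ ψ : 𝓓(ballTwo n, ℝ)) (a b : ℝ),
      ∫ x, u x * Δ (fun y => a * φ y + b * ψ y) x =
        a * (∫ x, u x * Δ (φ : EuclideanSpace ℝ (Fin n) → ℝ) x) +
          b * ∫ x, u x * Δ (ψ : EuclideanSpace ℝ (Fin n) → ℝ) x := fun φ ψ a b =>
    integral_mul_laplacian_const_mul_add hloc φ.contDiff φ.hasCompactSupport φ.tsupport_subset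
      ψ.contDiff ψ.hasCompactSupport ψ.tsupport_subset a b
  let L : 𝓓(ballTwo n, ℝ) →ₗ[ℝ] ℝ :=
    { toFun := fun φ => negLaplacianPairing u φ
      map_add' := fun φ ψ => by
        have h := hlin φ ψ 1 1
        simp only [one_mul] at h
        rw [hpair, hpair, hpair, ← neg_add, ← h]
        rfl
      map_smul' := fun a φ => by
        have h := hlin φ φ a 0
        simp only [zero_mul, add_zero] at h
        rw [hpair, hpair, RingHom.id_apply, smul_eq_mul, mul_neg, ← h]
        rfl }
  obtain ⟨F, hF⟩ := exists_continuousLinearMap_comp_eq J L (A * c) fun φ => by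
    have h := hbound φ φ.contDiff φ.hasCompactSupport φ.tsupport_subset (c * ‖J φ‖)
      fun x hx => hsob (R φ) ⟨x, hx⟩
    change |negLaplacianPairing u φ| ≤ _
    rwa [hpair, abs_neg, mul_assoc]
  have hp : p ≤ 2 := hp2.le.trans (by rw [div_le_iff₀ (by linarith)]; linarith)
  obtain ⟨v, hv, hvF⟩ := exists_distributionΓ_memNegSobolev hn2 F hp
  exact ⟨v, hv, fun φ => (hF φ).symm.trans (hvF (restrictΓ hn2 φ)).symm⟩
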